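/- **Setting.** Let $\mathcal S,\mathcal A$ be finite sets with $S=|\mathcal S|\ge 1$ and $A=|\mathcal A|\ge 2$, let $H\ge 1$, $\gamma\in(0,1]$, $\varepsilon>0$, $\delta\in(0,1)$, and $s_1\in\mathcal S$. Consider an episodic MDP with transition probabilities $p_h(\cdot\mid s,a)$ and a known deterministic reward function $r_h(s,a)\in[0,1]$, $h\in[H]=\{1,\dots,H\}$. A policy is a family of maps $\pi_h:\mathcal S\to\mathcal A$, $h\in[H]$. Its value is $V_1^\pi(s_1)=\mathbb E^\pi\big[\sum_{h=1}^H\gamma^{h-1}r_h(s_h,a_h)\big]$, where $a_h=\pi_h(s_h)$ and $s_{h+1}\sim p_h(\cdot\mid s_h,a_h)$, and $V_1^\star(s_1)=\max_\pi V_1^\pi(s_1)$. Put $\sigma_h=\sum_{i=0}^{h-1}\gamma^i$. **Confidence bounds.** After $t$ episodes let $n_h^t(s,a)$ and $n_h^t(s,a,s')$ be the numbers of episodes $i\le t$ with $(s_h^i,a_h^i)=(s,a)$, respectively $(s_h^i,a_h^i,s_{h+1}^i)=(s,a,s')$. Let $\hat p_h^t(s'\mid s,a)=n_h^t(s,a,s')/n_h^t(s,a)$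 if $n_h^t(s,a)>0$ and $1/S$ otherwise. With $$\beta(n,\delta)=\log\frac{2SAH}{\delta}+(S-1)\log\Big(e\Big(1+\frac n{S-1}\Big)\Big)$$ let $$\mathcal C_h^t(s,a)=\Big\{q \text{ a probability vector on }\mathcal S:\ \mathrm{KL}\big(\hat p_h^t(\cdot\mid s,a),q\big)\le \frac{\beta(n_h^t(s,a),\delta)}{n_h^t(s,a)}\Big\},$$ where $1/0=+\infty$ and $\mathrm{KL}(p,q)=\sum_s p(s)\log\frac{p(s)}{q(s)}$, which is $+\infty$ unless $p\ll q$. Put $\overline V_{H+1}^t=\underline V_{H+1}^t=0$ and, for $h=H,\dots,1$, $$\overline Q_h^t(s,a)=r_h(s,a)+\gamma\max_{q\in\mathcal C_h^t(s,a)}\sum_{s'}q(s')\overline V_{h+1}^t(s'),\qquad \overline V_h^t(s)=\max_a\overline Q_h^t(s,a),$$ $$\underline Q_h^t(s,a)=r_h(s,a)+\gamma\min_{q\in\mathcal C_h^t(s,a)}\sum_{s'}q(s')\underline V_{h+1}^t(s'),\qquad \underline V_h^t(s)=\max_a\underline Q_h^t(s,a).$$ **BPI-UCRL.** For every $t\ge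 0$, episode $t+1$ is played from $s_1$ with a policy $\pi^{t+1}$ that is greedy for $\overline Q^t$. The stopping time is $\tau=\inf\{t\in\mathbb N:\overline V_1^t(s_1)-\underline V_1^t(s_1)\le\varepsilon\}$, where $t=0$ is allowed. The recommended policy $\hat\pi_\tau$ is greedy for $\underline Q^\tau$. Ties are broken arbitrarily, as a function of the data collected so far. **Theorem.** BPI-UCRL with this threshold $\beta$ is $(\varepsilon,\delta)$-correct for best-policy identification: for all transition probabilities, $$\mathbb P\big(\tau<\infty\ \text{ and }\ V_1^\star(s_1)-V_1^{\hat\pi_\tau}(s_1)\le\varepsilon\big)\ge 1-\delta .$$ Moreover, with probability at least $1-\delta$, one has $\tau\le\max(0,B)$ where $$B=\frac{\mathcal C_HSA}{\varepsilon^2}\left[\log\frac{2SAH}{\delta}+2(S-1)\log\left(\frac{\mathcal C_HSA}{\varepsilon^2}\left(\log\frac{2SAH}{\delta}+(S-1)\Big(\sqrt e+\sqrt{\tfrac e{S-1}}\Big)\right)\right)+(S-1)\right]$$ and $\mathcal C_H=64(1+\sqrt2)^2\sigma_H^4$. For $S=1$ all terms with a factor $S-1$ are read as $0$. If $\varepsilon\le\sigma_H$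 then $B\ge 0$, so that the bound is $\tau\le B$. -/

import Mathlib

namespace BPI

noncomputable section

/-- A deterministic, step-dependent policy. Steps are numbered `0, …, H - 1`. -/
abbrev Policy (S A : Type*) (H : ℕ) := Fin H → S → A

/-- An episode: the visited states (including the state reached after the last action) and the
actions played. -/
abbrev Episode (S A : Type*) (H : ℕ) := (Fin (H + 1) → S) × (Fin H → A)

/-- The data collected in the first `t` episodes. -/
abbrev History (S A : Type*) (H t : ℕ) := Fin t → Episode S A H

section MDP

variable {S A : Type*} [Fintype S] [Fintype A] [DecidableEq S] [DecidableEq A] {H : ℕ}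

/-- The probability of the episode `z` when the policy `π` is played from the initial state `s₁`
in the MDP with transition probabilities `p h s a s'`. -/
def episodeProb (p : Fin H → S → A → S → ℝ) (π : Policy S A H) (s₁ : S)
    (z : Episode S A H) : ℝ :=
  (if z.1 0 = s₁ then 1 else 0) *
    ∏ h : Fin H, (if z.2 h = π h (z.1 h.castSucc) then 1 else 0) *
      p h (z.1 h.castSucc) (z.2 h) (z.1 h.succ)

/-- The discounted sum of rewards along an episode. -/
def episodeReturn (γ : ℝ) (r : Fin H → S → A → ℝ) (z : Episode S A H) : ℝ :=
  ∑ h : Fin H, γ ^ (h : ℕ) * r h (z.1 h.castSucc) (z.2 h)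

/-- The value of `π` in the first step, from state `s₁`: the expected discounted return. -/
def value (γ : ℝ) (r : Fin H → S → A → ℝ) (p : Fin H → S → A → S → ℝ) (π : Policy S A H)
    (s₁ : S) : ℝ :=
  ∑ z : Episode S A H, episodeProb p π s₁ z * episodeReturn γ r z

/-- The optimal value in the first step: the maximum over the finitely many policies. -/
def optValue (γ : ℝ) (r : Fin H → S → A → ℝ) (p : Fin H → S → A → S → ℝ) (s₁ : S) : ℝ :=
  ⨆ π : Policy S A H, value γ r p π s₁

/-! ### Counts, empirical transitions and confidence regions -/

/-- Number of visits of `(s, a)` in step `h`. -/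
def count {t : ℕ} (D : History S A H t) (h : Fin H) (s : S) (a : A) : ℕ :=
  (Finset.univ.filter fun i : Fin t => (D i).1 h.castSucc = s ∧ (D i).2 h = a).card

/-- Number of transitions from `(s, a)` to `s'` in step `h`. -/
def countNext {t : ℕ} (D : History S A H t) (h : Fin H) (s : S) (a : A) (s' : S) : ℕ :=
  (Finset.univ.filter fun i : Fin t =>
    (D i).1 h.castSucc = s ∧ (D i).2 h = a ∧ (D i).1 h.succ = s').card

/-- Empirical transition probabilities, uniform for unvisited pairs. -/
def empirical {t : ℕ} (D : History S A H t) (h : Fin H) (s : S) (a : A) (s' : S) : ℝ :=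
  if count D h s a = 0 then 1 / (Fintype.card S : ℝ)
  else (countNext D h s a s' : ℝ) / (count D h s a : ℝ)

/-- Kullback–Leibler divergence of two probability vectors; it is `⊤` unless `p` is absolutely
continuous with respect to `q`. -/
def kl (p q : S → ℝ) : EReal :=
  open Classical in
  if ∀ s, q s = 0 → p s = 0 then ((∑ s, p s * Real.log (p s / q s) : ℝ) : EReal) else ⊤

/-- The threshold
`β(n, δ) = log (2 S A H / δ) + (S - 1) log (e (1 + n / (S - 1)))`, where `nS`, `nA` are the numbers
of states and actions. For `nS = 1` the second summand is `0`. -/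
def threshold (nS nA H : ℕ) (δ : ℝ) (n : ℝ) : ℝ :=
  Real.log (2 * nS * nA * H / δ) +
    ((nS : ℝ) - 1) * Real.log (Real.exp 1 * (1 + n / ((nS : ℝ) - 1)))

/-- The confidence radius `β(n, δ) / n`, with the convention `1 / 0 = +∞`. -/
def radius (nS nA H : ℕ) (δ : ℝ) (n : ℕ) : EReal :=
  if n = 0 then ⊤ else ((threshold nS nA H δ n / n : ℝ) : EReal)

/-- The confidence region for the transition probabilities from `(s, a)` in step `h`. -/
def confRegion (δ : ℝ) {t : ℕ} (D : History S A H t) (h : Fin H) (s : S) (a : A) :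
    Set (S → ℝ) :=
  {q | q ∈ stdSimplex ℝ S ∧
    kl (empirical D h s a) q ≤ radius (Fintype.card S) (Fintype.card A) H δ (count D h s a)}

/-! ### Confidence bounds on the optimal value functions -/

/-- `r_h(s, a) + γ max_{q ∈ C_h(s, a)} ∑ s', q(s') W(s')`. -/
def upperBackup (γ δ : ℝ) (r : Fin H → S → A → ℝ) {t : ℕ} (D : History S A H t)
    (h : Fin H) (W : S → ℝ) (s : S) (a : A) : ℝ :=
  r h s a + γ * sSup ((fun q : S → ℝ => ∑ s', q s' * W s') '' confRegion δ D h s a)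

/-- `r_h(s, a) + γ min_{q ∈ C_h(s, a)} ∑ s', q(s') W(s')`. -/
def lowerBackup (γ δ : ℝ) (r : Fin H → S → A → ℝ) {t : ℕ} (D : History S A H t)
    (h : Fin H) (W : S → ℝ) (s : S) (a : A) : ℝ :=
  r h s a + γ * sInf ((fun q : S → ℝ => ∑ s', q s' * W s') '' confRegion δ D h s a)

/-- Upper confidence bound on the optimal value function, by backward induction from
`0` after the last step. -/
def upperV (γ δ : ℝ) (r : Fin H → S → A → ℝ) {t : ℕ} (D : History S A H t) :
    Fin (H + 1) → S → ℝ :=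
  Fin.reverseInduction (motive := fun _ => S → ℝ) (fun _ => 0)
    (fun h W s => ⨆ a, upperBackup γ δ r D h W s a)

/-- Lower confidence bound on the optimal value function. -/
def lowerV (γ δ : ℝ) (r : Fin H → S → A → ℝ) {t : ℕ} (D : History S A H t) :
    Fin (H + 1) → S → ℝ :=
  Fin.reverseInduction (motive := fun _ => S → ℝ) (fun _ => 0)
    (fun h W s => ⨆ a, lowerBackup γ δ r D h W s a)

/-- Upper confidence bound on the optimal Q-value function. -/
def upperQ (γ δ : ℝ) (r : Fin H → S → A → ℝ) {t : ℕ} (D : History S A H t)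
    (h : Fin H) (s : S) (a : A) : ℝ :=
  upperBackup γ δ r D h (upperV γ δ r D h.succ) s a

/-- Lower confidence bound on the optimal Q-value function. -/
def lowerQ (γ δ : ℝ) (r : Fin H → S → A → ℝ) {t : ℕ} (D : History S A H t)
    (h : Fin H) (s : S) (a : A) : ℝ :=
  lowerBackup γ δ r D h (lowerV γ δ r D h.succ) s a

end MDP

/-! ### Algorithms for best-policy identification -/

/-- `policy t D` is played in the episode that follows the data `D` of the first `t` episodes,
`halts t D` says whether the stopping condition holds after these data, and `recommend t D` is the
policy that is returned if the algorithm stops there. -/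
structure Algorithm (S A : Type*) (H : ℕ) where
  policy : (t : ℕ) → History S A H t → Policy S A H
  halts : (t : ℕ) → History S A H t → Prop
  recommend : (t : ℕ) → History S A H t → Policy S A H

/-- `π` is greedy for `Q`. -/
def IsGreedy {S A : Type*} {H : ℕ} (Q : Fin H → S → A → ℝ) (π : Policy S A H) : Prop :=
  ∀ h s a, Q h s a ≤ Q h s (π h s)

section Run

variable {S A : Type*} [Fintype S] [Fintype A] [DecidableEq S] [DecidableEq A] {H : ℕ}

/-- `alg` is BPI-UCRL for the reward function `r`, with an arbitrary rule for breaking ties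
in the two argmax. -/
structure IsBPIUCRL (alg : Algorithm S A H) (γ ε δ : ℝ) (r : Fin H → S → A → ℝ) (s₁ : S) :
    Prop where
  greedy_upper : ∀ t (D : History S A H t), IsGreedy (upperQ γ δ r D) (alg.policy t D)
  halts_iff : ∀ t (D : History S A H t),
    alg.halts t D ↔ upperV γ δ r D 0 s₁ - lowerV γ δ r D 0 s₁ ≤ ε
  greedy_lower : ∀ t (D : History S A H t), IsGreedy (lowerQ γ δ r D) (alg.recommend t D)

/-- The data of the first `t` episodes of the sequence `Z`. -/
def historyOf {Ω : Type*} (Z : ℕ → Ω → Episode S A H) (t : ℕ) (ω : Ω) : History S A H t :=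
  fun i => Z i ω

/-- The random episodes `Z 0, Z 1, …` are generated by `alg` in the MDP with transitions `p` and
initial state `s₁`: given the first `i` episodes, episode `i` is distributed as an episode of the
policy that `alg` selects from them. -/
structure IsRun {Ω : Type*} [MeasurableSpace Ω] (μ : MeasureTheory.Measure Ω)
    (alg : Algorithm S A H) (p : Fin H → S → A → S → ℝ) (s₁ : S)
    (Z : ℕ → Ω → Episode S A H) : Prop where
  measurable : ∀ t z, MeasurableSet {ω | Z t ω = z}
  law : ∀ (t : ℕ) (z : ℕ → Episode S A H),
    μ.real {ω | ∀ i < t, Z i ω = z i} =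
      ∏ i ∈ Finset.range t,
        episodeProb p (alg.policy i fun j : Fin i => z j) s₁ (z i)

/-- The stopping time: the first `t ≥ 0` at which the stopping condition holds, `⊤` if there is
none. -/
def stoppingTime {Ω : Type*} (alg : Algorithm S A H) (Z : ℕ → Ω → Episode S A H) (ω : Ω) : ℕ∞ :=
  sInf ((fun t : ℕ => (t : ℕ∞)) '' {t | alg.halts t (historyOf Z t ω)})

/-- The algorithm stops and the policy that it returns is `ε`-optimal. -/
def Succeeds {Ω : Type*} (alg : Algorithm S A H) (γ ε : ℝ) (r : Fin H → S → A → ℝ)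
    (p : Fin H → S → A → S → ℝ) (s₁ : S) (Z : ℕ → Ω → Episode S A H) (ω : Ω) : Prop :=
  ∃ t : ℕ, stoppingTime alg Z ω = t ∧
    optValue γ r p s₁ - value γ r p (alg.recommend t (historyOf Z t ω)) s₁ ≤ ε

end Run

/-- `σ_h = ∑_{i < h} γ ^ i`. -/
def sigma (γ : ℝ) (h : ℕ) : ℝ := ∑ i ∈ Finset.range h, γ ^ i

/-- `C_H = 64 (1 + √2)² σ_H⁴`. -/
def constC (γ : ℝ) (H : ℕ) : ℝ := 64 * (1 + √2) ^ 2 * sigma γ H ^ 4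

/-- The bound on the stopping time. For `nS = 1` all terms with a factor `nS - 1` are `0`. -/
def sampleBound (nS nA H : ℕ) (γ ε δ : ℝ) : ℝ :=
  constC γ H * nS * nA / ε ^ 2 *
    (Real.log (2 * nS * nA * H / δ) +
      2 * ((nS : ℝ) - 1) *
        Real.log (constC γ H * nS * nA / ε ^ 2 *
          (Real.log (2 * nS * nA * H / δ) +
            ((nS : ℝ) - 1) * (√(Real.exp 1) + √(Real.exp 1 / ((nS : ℝ) - 1))))) +
      ((nS : ℝ) - 1))

end

end BPI

/-! Both claims hold on one regular event of probability at least `1 - δ`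
(`IsRun.one_sub_le_real_isRegular`): the true transition probabilities lie in every confidence
region, and every visit count is at least half the sum of its conditional visit probabilities, up to
`log (2SAH/δ)`. Each of the two properties, for each triple `(h, s, a)`, comes from a nonnegative
supermartingale and Ville's inequality at level `2SAH/δ`, so the union bound costs exactly `δ`. For
the regions the supermartingale is a likelihood ratio of a uniform mixture against the truth; its
logarithm is `n · KL` up to a binomial coefficient, which yields the second summand of `β`. For the
counts it is the exponential of half the conditional visit probabilities minus the visits.

Correctness is then deterministic. The upper bound solves a Bellman inequality that dominates every
policy, and the lower bound solves one that the recommended policy dominates. At the stopping time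
the two differ by at most `ε`.

For the sample complexity, the gap between the bounds is at most the value of the played policy when
the rewards are the widths of the confidence regions (`upperV_sub_lowerV_le_value`). Before stopping
every gap exceeds `ε`. Summing over `T` episodes, replacing counts by conditional counts, and using
a telescoping sum and Cauchy–Schwarz gives `T ε ≲ σ² √(β(T) S A T)`, that is `T ≤ K β(T)`
(`IsRegular.le_mul_threshold`). As `β` grows logarithmically, this implicit inequality can be solved
for `T` (`le_mul_of_le_mul_threshold`). -/

namespace BPI

noncomputable section

set_option linter.unusedSectionVars false

/-! ### Expectations over one episode, and Bellman inequalities. -/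

section Episodes

variable {S A : Type*} [Fintype S] [Fintype A] [DecidableEq S] [DecidableEq A]

/-- The expectation of `F` over an episode of `π`. -/
def episodeMean {H : ℕ} (p : Fin H → S → A → S → ℝ) (π : Policy S A H) (s₁ : S)
    (F : Episode S A H → ℝ) : ℝ :=
  ∑ z, episodeProb p π s₁ z * F z

/-- The probability that `π` plays `a` in state `s` in step `h`. -/
def occupancy {H : ℕ} (p : Fin H → S → A → S → ℝ) (π : Policy S A H) (s₁ : S)
    (h : Fin H) (s : S) (a : A) : ℝ :=
  episodeMean p π s₁ fun z => if z.1 h.castSucc = s ∧ z.2 h = a then 1 else 0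

variable {H : ℕ}

lemma episodeProb_nonneg {p : Fin H → S → A → S → ℝ} (hp : ∀ h s a, p h s a ∈ stdSimplex ℝ S)
    (π : Policy S A H) (s₁ : S) (z : Episode S A H) : 0 ≤ episodeProb p π s₁ z := by
  unfold episodeProb
  refine mul_nonneg (by split_ifs <;> simp) (Finset.prod_nonneg fun h _ => ?_)
  exact mul_nonneg (by split_ifs <;> simp) ((hp h _ _).1 _)

lemma transition_ne_zero_of_episodeProb_ne_zero {p : Fin H → S → A → S → ℝ} {π : Policy S A H}
    {s₁ : S} {z : Episode S A H} (hz : episodeProb p π s₁ z ≠ 0) (h : Fin H) :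
    p h (z.1 h.castSucc) (z.2 h) (z.1 h.succ) ≠ 0 := by
  intro h0
  apply hz
  unfold episodeProb
  rw [Finset.prod_eq_zero (Finset.mem_univ h) (by rw [h0, mul_zero]), mul_zero]

lemma episodeMean_mono {p : Fin H → S → A → S → ℝ} (hp : ∀ h s a, p h s a ∈ stdSimplex ℝ S)
    (π : Policy S A H) (s₁ : S) {F G : Episode S A H → ℝ} (hFG : ∀ z, F z ≤ G z) :
    episodeMean p π s₁ F ≤ episodeMean p π s₁ G :=
  Finset.sum_le_sum fun z _ => mul_le_mul_of_nonneg_left (hFG z) (episodeProb_nonneg hp π s₁ z)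

/-- First-step decomposition: the remainder of an episode is an episode of the shifted MDP. All
inductions on `H` below rest on it. -/
lemma episodeMean_cons (p : Fin (H + 1) → S → A → S → ℝ) (π : Policy S A (H + 1)) (s₁ : S)
    (F : Episode S A (H + 1) → ℝ) :
    episodeMean p π s₁ F = ∑ s', p 0 s₁ (π 0 s₁) s' *
      episodeMean (fun h => p h.succ) (fun h => π h.succ) s' fun z =>
        F (Fin.cons s₁ z.1, Fin.cons (π 0 s₁) z.2) := by
  unfold episodeMean
  rw [Fintype.sum_prod_type, ← (Fin.consEquiv fun _ : Fin (H + 2) => S).sum_comp,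
    Fintype.sum_prod_type]
  simp_rw [← (Fin.consEquiv fun _ : Fin (H + 1) => A).sum_comp, Fintype.sum_prod_type]
  have key : ∀ (s : S) (x : Fin (H + 1) → S) (b : A) (a : Fin H → A),
      episodeProb p π s₁ ((Fin.cons s x : Fin (H + 2) → S), (Fin.cons b a : Fin (H + 1) → A)) =
        if s = s₁ then (if b = π 0 s then p 0 s b (x 0) *
          episodeProb (fun h => p h.succ) (fun h => π h.succ) (x 0) (x, a) else 0) else 0 := by
    intro s x b a
    unfold episodeProb
    rw [Fin.prod_univ_succ]
    simp only [Fin.cons_zero, Fin.castSucc_zero, Fin.cons_succ, ← Fin.succ_castSucc]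
    have : (Fin.cons s x : Fin (H + 2) → S) (Fin.succ 0) = x 0 := Fin.cons_succ _ _ _
    simp only [if_true]
    split_ifs <;> simp
  simp only [Fin.consEquiv, Equiv.coe_fn_mk, key]
  rw [Finset.sum_eq_single s₁ (by intro s _ hs; simp [hs]) (by simp)]
  simp only [if_true]
  have h2 : ∀ x : Fin (H + 1) → S, (∑ b : A, ∑ a : Fin H → A,
      (if b = π 0 s₁ then p 0 s₁ b (x 0) *
        episodeProb (fun h => p h.succ) (fun h => π h.succ) (x 0) (x, a) else 0) *
          F (Fin.cons s₁ x, Fin.cons b a)) = ∑ a : Fin H → A, p 0 s₁ (π 0 s₁) (x 0) *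
        episodeProb (fun h => p h.succ) (fun h => π h.succ) (x 0) (x, a) *
          F (Fin.cons s₁ x, Fin.cons (π 0 s₁) a) := by
    intro x
    rw [Finset.sum_eq_single (π 0 s₁) (by intro b _ hb; simp [hb]) (by simp)]
    simp
  rw [Finset.sum_congr rfl fun x _ => h2 x]
  simp only [Finset.mul_sum]
  conv_rhs => rw [Finset.sum_comm]
  refine Finset.sum_congr rfl fun x _ => ?_
  -- The tail's `episodeProb` from `s'` vanishes unless the tail starts in `s'`, which collapses the
  -- sum over `s'`.
  rw [Finset.sum_eq_single (x 0)]
  · exact Finset.sum_congr rfl fun a _ => by ring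
  · intro s _ hs
    refine Finset.sum_eq_zero fun a _ => ?_
    simp [episodeProb, hs.symm]
  · simp

lemma episodeMean_congr_initial (p : Fin H → S → A → S → ℝ) (π : Policy S A H) (s₁ : S)
    {F G : Episode S A H → ℝ} (hFG : ∀ z, z.1 0 = s₁ → F z = G z) :
    episodeMean p π s₁ F = episodeMean p π s₁ G := by
  refine Finset.sum_congr rfl fun z _ => ?_
  by_cases hz : z.1 0 = s₁
  · rw [hFG z hz]
  · simp [episodeProb, hz]

lemma episodeMean_const {p : Fin H → S → A → S → ℝ} (hp : ∀ h s a, p h s a ∈ stdSimplex ℝ S)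
    (π : Policy S A H) (s₁ : S) (c : ℝ) : episodeMean p π s₁ (fun _ => c) = c := by
  induction H generalizing s₁ with
  | zero =>
    unfold episodeMean
    rw [Fintype.sum_prod_type, ← (Equiv.funUnique (Fin 1) S).symm.sum_comp]
    simp [episodeProb]
  | succ H ih =>
    rw [episodeMean_cons]
    simp_rw [ih (fun h => hp h.succ)]
    rw [← Finset.sum_mul, (hp 0 _ _).2, one_mul]

lemma episodeMean_const_add_mul {p : Fin H → S → A → S → ℝ}
    (hp : ∀ h s a, p h s a ∈ stdSimplex ℝ S) (π : Policy S A H) (s₁ : S) (c d : ℝ)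
    (F : Episode S A H → ℝ) :
    episodeMean p π s₁ (fun z => c + d * F z) = c + d * episodeMean p π s₁ F := by
  conv_rhs => rw [← episodeMean_const hp π s₁ c]
  unfold episodeMean
  rw [Finset.mul_sum, ← Finset.sum_add_distrib]
  exact Finset.sum_congr rfl fun z _ => by ring

/-- The Markov property at step `h`: the next state can be averaged out given the current state and
action. It reduces the supermartingale property for transition counts to a statement about `p h s a`
alone. -/
lemma episodeMean_transition {p : Fin H → S → A → S → ℝ}
    (hp : ∀ h s a, p h s a ∈ stdSimplex ℝ S) (π : Policy S A H) (s₁ : S) (h : Fin H)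
    (g : S → A → S → ℝ) :
    episodeMean p π s₁ (fun z => g (z.1 h.castSucc) (z.2 h) (z.1 h.succ)) =
      episodeMean p π s₁ fun z =>
        ∑ s', p h (z.1 h.castSucc) (z.2 h) s' * g (z.1 h.castSucc) (z.2 h) s' := by
  induction H generalizing s₁ with
  | zero => exact h.elim0
  | succ H ih =>
    rw [episodeMean_cons, episodeMean_cons]
    induction h using Fin.cases with
    | zero =>
      simp only [Fin.castSucc_zero, Fin.cons_zero, Fin.cons_succ]
      simp_rw [episodeMean_const (fun h => hp h.succ), ← Finset.sum_mul]
      rw [(hp 0 _ _).2, one_mul]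
      refine Finset.sum_congr rfl fun s' _ => ?_
      rw [episodeMean_congr_initial (G := fun _ => g s₁ (π 0 s₁) s') _ _ _ fun z hz => by rw [hz],
        episodeMean_const fun h => hp h.succ]
    | succ h =>
      simp only [← Fin.succ_castSucc, Fin.cons_succ]
      exact Finset.sum_congr rfl fun s' _ => by rw [ih fun h => hp h.succ]

lemma value_succ {γ : ℝ} {r : Fin (H + 1) → S → A → ℝ} {p : Fin (H + 1) → S → A → S → ℝ}
    (hp : ∀ h s a, p h s a ∈ stdSimplex ℝ S) (π : Policy S A (H + 1)) (s₁ : S) :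
    value γ r p π s₁ = r 0 s₁ (π 0 s₁) + γ * ∑ s', p 0 s₁ (π 0 s₁) s' *
      value γ (fun h => r h.succ) (fun h => p h.succ) (fun h => π h.succ) s' := by
  have h1 : value γ r p π s₁ = episodeMean p π s₁ (episodeReturn γ r) := rfl
  rw [h1, episodeMean_cons]
  have h2 : ∀ s', episodeMean (fun h => p h.succ) (fun h => π h.succ) s' (fun z =>
      episodeReturn γ r (Fin.cons s₁ z.1, Fin.cons (π 0 s₁) z.2)) =
      r 0 s₁ (π 0 s₁) +
        γ * value γ (fun h => r h.succ) (fun h => p h.succ) (fun h => π h.succ) s' := by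
    intro s'
    have h3 : ∀ z : Episode S A H,
        episodeReturn γ r (Fin.cons s₁ z.1, Fin.cons (π 0 s₁) z.2) =
          r 0 s₁ (π 0 s₁) + γ * episodeReturn γ (fun h => r h.succ) z := by
      intro z
      unfold episodeReturn
      rw [Fin.sum_univ_succ, Finset.mul_sum]
      simp only [Fin.castSucc_zero, Fin.cons_zero, ← Fin.succ_castSucc, Fin.cons_succ,
        Fin.val_zero, pow_zero, one_mul, Fin.val_succ, pow_succ]
      congr 1
      exact Finset.sum_congr rfl fun h _ => by ring
    simp only [h3]
    exact episodeMean_const_add_mul (fun h => hp h.succ) _ _ _ _ _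
  simp_rw [h2, mul_add, Finset.sum_add_distrib, ← Finset.sum_mul]
  rw [(hp 0 _ _).2, one_mul, Finset.mul_sum]
  congr 1
  exact Finset.sum_congr rfl fun z _ => by ring

/-- A supersolution of the policy's Bellman equation dominates its value, by backward induction;
`le_value_of_bellman` is the same fact for negated rewards. -/
lemma value_le_of_bellman {γ : ℝ} (hγ : 0 ≤ γ) {r : Fin H → S → A → ℝ}
    {p : Fin H → S → A → S → ℝ} (hp : ∀ h s a, p h s a ∈ stdSimplex ℝ S) (π : Policy S A H)
    (W : Fin (H + 1) → S → ℝ) (hlast : ∀ s, 0 ≤ W (Fin.last H) s)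
    (hW : ∀ h s, r h s (π h s) + γ * ∑ s', p h s (π h s) s' * W h.succ s' ≤ W h.castSucc s)
    (s₁ : S) : value γ r p π s₁ ≤ W 0 s₁ := by
  induction H generalizing s₁ with
  | zero => simpa [value, episodeReturn] using hlast s₁
  | succ H ih =>
    rw [value_succ hp]
    refine le_trans ?_ (hW 0 s₁)
    gcongr with s' _
    · exact (hp 0 _ _).1 _
    · exact ih (fun h => hp h.succ) (fun h => π h.succ) (fun h => W h.succ)
        (fun s => by simpa using hlast s) (fun h s => by simpa using hW h.succ s) s'

lemma value_neg (γ : ℝ) (r : Fin H → S → A → ℝ) (p : Fin H → S → A → S → ℝ)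
    (π : Policy S A H) (s₁ : S) :
    value γ (fun h s a => -r h s a) p π s₁ = -value γ r p π s₁ := by
  simp [value, episodeReturn, Finset.sum_neg_distrib]

lemma le_value_of_bellman {γ : ℝ} (hγ : 0 ≤ γ) {r : Fin H → S → A → ℝ}
    {p : Fin H → S → A → S → ℝ} (hp : ∀ h s a, p h s a ∈ stdSimplex ℝ S) (π : Policy S A H)
    (W : Fin (H + 1) → S → ℝ) (hlast : ∀ s, W (Fin.last H) s ≤ 0)
    (hW : ∀ h s, W h.castSucc s ≤ r h s (π h s) + γ * ∑ s', p h s (π h s) s' * W h.succ s')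
    (s₁ : S) : W 0 s₁ ≤ value γ r p π s₁ := by
  have := value_le_of_bellman hγ (r := fun h s a => -r h s a) hp π (fun h s => -W h s)
    (fun s => by simpa using hlast s)
    (fun h s => by
      have := hW h s
      simp only [mul_neg, Finset.sum_neg_distrib]
      linarith) s₁
  rw [value_neg] at this
  linarith

lemma occupancy_nonneg {p : Fin H → S → A → S → ℝ} (hp : ∀ h s a, p h s a ∈ stdSimplex ℝ S)
    (π : Policy S A H) (s₁ : S) (h : Fin H) (s : S) (a : A) : 0 ≤ occupancy p π s₁ h s a :=
  Finset.sum_nonneg fun z _ => mul_nonneg (episodeProb_nonneg hp π s₁ z)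
    (by dsimp only; split_ifs <;> simp)

lemma sum_occupancy {p : Fin H → S → A → S → ℝ} (hp : ∀ h s a, p h s a ∈ stdSimplex ℝ S)
    (π : Policy S A H) (s₁ : S) (h : Fin H) :
    ∑ x : S × A, occupancy p π s₁ h x.1 x.2 = 1 := by
  rw [← episodeMean_const hp π s₁ 1]
  unfold occupancy episodeMean
  rw [Finset.sum_comm]
  refine Finset.sum_congr rfl fun z _ => ?_
  rw [← Finset.mul_sum, Finset.sum_eq_single (z.1 h.castSucc, z.2 h)]
  · simp
  · rintro ⟨s, a⟩ _ hx
    dsimp only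
    rw [if_neg]
    rintro ⟨rfl, rfl⟩
    exact hx rfl
  · simp

lemma occupancy_le_one {p : Fin H → S → A → S → ℝ} (hp : ∀ h s a, p h s a ∈ stdSimplex ℝ S)
    (π : Policy S A H) (s₁ : S) (h : Fin H) (s : S) (a : A) : occupancy p π s₁ h s a ≤ 1 := by
  rw [← sum_occupancy hp π s₁ h]
  exact Finset.single_le_sum (f := fun x : S × A => occupancy p π s₁ h x.1 x.2)
    (fun x _ => occupancy_nonneg hp π s₁ h x.1 x.2) (Finset.mem_univ (s, a))

lemma value_eq_sum_occupancy (γ : ℝ) (r : Fin H → S → A → ℝ) (p : Fin H → S → A → S → ℝ)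
    (π : Policy S A H) (s₁ : S) :
    value γ r p π s₁ =
      ∑ h : Fin H, γ ^ (h : ℕ) * ∑ x : S × A, occupancy p π s₁ h x.1 x.2 * r h x.1 x.2 := by
  unfold value episodeReturn occupancy episodeMean
  simp only [Finset.mul_sum, Finset.sum_mul]
  rw [Finset.sum_comm]
  refine Finset.sum_congr rfl fun h _ => ?_
  rw [Finset.sum_comm]
  refine Finset.sum_congr rfl fun z _ => ?_
  rw [Finset.sum_eq_single (z.1 h.castSucc, z.2 h)]
  · simp only [and_self, if_true]
    ring
  · rintro ⟨s, a⟩ _ hx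
    rw [if_neg]
    · ring
    rintro ⟨rfl, rfl⟩
    exact hx rfl
  · simp

end Episodes

/-! ### Ville's inequality for the sequence of episodes. -/

section Ville

variable {S A : Type*} [Fintype S] [Fintype A] [DecidableEq S] [DecidableEq A] {H : ℕ}
  {Ω : Type*} [MeasurableSpace Ω] {μ : MeasureTheory.Measure Ω}
  [MeasureTheory.IsProbabilityMeasure μ] {alg : Algorithm S A H} {p : Fin H → S → A → S → ℝ}
  {s₁ : S} {Z : ℕ → Ω → Episode S A H}

lemma IsRun.real_historyOf_snoc (hZ : IsRun μ alg p s₁ Z) {t : ℕ} (D : History S A H t)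
    (e : Episode S A H) :
    μ.real {ω | historyOf Z (t + 1) ω = Fin.snoc (α := fun _ => Episode S A H) D e} =
      μ.real {ω | historyOf Z t ω = D} * episodeProb p (alg.policy t D) s₁ e := by
  set z : ℕ → Episode S A H := fun i => if h : i < t then D ⟨i, h⟩ else e with hz
  have hD : (fun j : Fin t => z j) = D := by
    funext j
    simp [hz]
  have h1 : {ω | historyOf Z t ω = D} = {ω | ∀ i < t, Z i ω = z i} := by
    ext ω
    simp only [Set.mem_ofPred_eq, ← hD, funext_iff, historyOf]
    exact ⟨fun h i hi => h ⟨i, hi⟩, fun h i => h i i.2⟩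
  have h2 : {ω | historyOf Z (t + 1) ω = Fin.snoc (α := fun _ => Episode S A H) D e} =
      {ω | ∀ i < t + 1, Z i ω = z i} := by
    have : Fin.snoc (α := fun _ => Episode S A H) D e = fun j : Fin (t + 1) => z j := by
      funext j
      refine Fin.lastCases ?_ (fun j => ?_) j <;> simp [hz]
    ext ω
    simp only [Set.mem_ofPred_eq, this, funext_iff, historyOf]
    exact ⟨fun h i hi => h ⟨i, hi⟩, fun h i => h i i.2⟩
  rw [h1, h2, hZ.law, hZ.law, Finset.prod_range_succ, hD]
  simp [hz]

/-- Ville's maximal inequality for a nonnegative supermartingale of the collected data. -/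
lemma IsRun.ville (hZ : IsRun μ alg p s₁ Z) (f : (t : ℕ) → History S A H t → ℝ)
    (hf0 : ∀ t D, 0 ≤ f t D)
    (hf : ∀ t D, episodeMean p (alg.policy t D) s₁
      (fun e => f (t + 1) (Fin.snoc (α := fun _ => Episode S A H) D e)) ≤ f t D)
    {c : ℝ} (hc : 0 < c) :
    μ.real {ω | ∃ t, c ≤ f t (historyOf Z t ω)} ≤ f 0 (fun i => i.elim0) / c := by
  -- Localised to given data `D` and to `k` further episodes, the claim follows by induction on `k`:
  -- either the level is already reached, or one conditions on the next episode.
  have key : ∀ (k t : ℕ) (D : History S A H t),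
      μ.real {ω | historyOf Z t ω = D ∧ ∃ u ≤ k, c ≤ f (t + u) (historyOf Z (t + u) ω)} ≤
        μ.real {ω | historyOf Z t ω = D} * (f t D / c) := by
    intro k
    induction k with
    | zero =>
      intro t D
      by_cases hD : c ≤ f t D
      · calc _ ≤ μ.real {ω | historyOf Z t ω = D} :=
              MeasureTheory.measureReal_mono fun ω h => h.1
          _ ≤ _ := le_mul_of_one_le_right MeasureTheory.measureReal_nonneg
              ((one_le_div hc).2 hD)
      · have : {ω | historyOf Z t ω = D ∧ ∃ u ≤ 0, c ≤ f (t + u) (historyOf Z (t + u) ω)} = ∅ := by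
          ext ω
          simp only [Set.mem_ofPred_eq, Set.mem_empty_iff_false, iff_false]
          rintro ⟨rfl, u, hu, h⟩
          obtain rfl : u = 0 := by omega
          exact hD h
        rw [this, MeasureTheory.measureReal_empty]
        exact mul_nonneg MeasureTheory.measureReal_nonneg (div_nonneg (hf0 t D) hc.le)
    | succ k ih =>
      intro t D
      by_cases hD : c ≤ f t D
      · calc _ ≤ μ.real {ω | historyOf Z t ω = D} :=
              MeasureTheory.measureReal_mono fun ω h => h.1
          _ ≤ _ := le_mul_of_one_le_right MeasureTheory.measureReal_nonneg
              ((one_le_div hc).2 hD)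
      · have hsub : {ω | historyOf Z t ω = D ∧
              ∃ u ≤ k + 1, c ≤ f (t + u) (historyOf Z (t + u) ω)} ⊆
            ⋃ e : Episode S A H, {ω | historyOf Z (t + 1) ω =
                Fin.snoc (α := fun _ => Episode S A H) D e ∧
              ∃ u ≤ k, c ≤ f (t + 1 + u) (historyOf Z (t + 1 + u) ω)} := by
          rintro ω ⟨hω, u, hu, h⟩
          refine Set.mem_iUnion.2 ⟨Z t ω, ?_, ?_⟩
          · subst hω
            funext j
            refine Fin.lastCases ?_ (fun j => ?_) j <;> simp [historyOf]
          · rcases u with _ | u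
            · subst hω
              exact absurd h hD
            · refine ⟨u, by omega, ?_⟩
              have : t + (u + 1) = t + 1 + u := by omega
              rwa [this] at h
        calc _ ≤ _ := MeasureTheory.measureReal_mono hsub
          _ ≤ ∑ e : Episode S A H, μ.real {ω | historyOf Z (t + 1) ω =
                Fin.snoc (α := fun _ => Episode S A H) D e ∧
              ∃ u ≤ k, c ≤ f (t + 1 + u) (historyOf Z (t + 1 + u) ω)} :=
              MeasureTheory.measureReal_iUnion_fintype_le _
          _ ≤ ∑ e : Episode S A H, μ.real {ω | historyOf Z t ω = D} *
              (episodeProb p (alg.policy t D) s₁ e *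
                f (t + 1) (Fin.snoc (α := fun _ => Episode S A H) D e)) / c := by
              refine Finset.sum_le_sum fun e _ => (ih _ _).trans_eq ?_
              rw [hZ.real_historyOf_snoc]
              ring
          _ = μ.real {ω | historyOf Z t ω = D} * (episodeMean p (alg.policy t D) s₁
              (fun e => f (t + 1) (Fin.snoc (α := fun _ => Episode S A H) D e)) / c) := by
              rw [← Finset.sum_div, ← Finset.mul_sum, mul_div_assoc]
              rfl
          _ ≤ _ := by
              gcongr
              exact hf t D
  have hmono : Monotone fun k : ℕ => {ω | ∃ u ≤ k, c ≤ f u (historyOf Z u ω)} :=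
    fun k l hkl ω ⟨u, hu, h⟩ => ⟨u, hu.trans hkl, h⟩
  have hU : {ω | ∃ t, c ≤ f t (historyOf Z t ω)} =
      ⋃ k : ℕ, {ω | ∃ u ≤ k, c ≤ f u (historyOf Z u ω)} := by
    ext ω
    simp only [Set.mem_ofPred_eq, Set.mem_iUnion]
    exact ⟨fun ⟨t, h⟩ => ⟨t, t, le_rfl, h⟩, fun ⟨_, u, _, h⟩ => ⟨u, h⟩⟩
  -- Continuity from below removes the horizon `k`.
  have hlim := (ENNReal.tendsto_toReal (MeasureTheory.measure_ne_top μ _)).comp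
    (MeasureTheory.tendsto_measure_iUnion_atTop (μ := μ) hmono)
  rw [hU]
  refine le_of_tendsto' hlim fun k => ?_
  have h0 := key k 0 fun i => i.elim0
  have huniv : {ω | historyOf Z 0 ω = fun i => i.elim0} = Set.univ :=
    Set.eq_univ_of_forall fun ω => funext fun i => i.elim0
  rw [huniv, MeasureTheory.probReal_univ, one_mul] at h0
  refine le_trans (MeasureTheory.measureReal_mono ?_) h0
  rintro ω ⟨u, hu, h⟩
  refine ⟨funext fun i => i.elim0, u, hu, ?_⟩
  rwa [← Nat.zero_add u] at h

/-- Almost surely, only transitions of positive probability are observed. -/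
lemma IsRun.real_null_transition (hp : ∀ h s a, p h s a ∈ stdSimplex ℝ S)
    (hZ : IsRun μ alg p s₁ Z) :
    μ.real {ω | ∃ t, ∃ i < t, ∃ h, p h ((Z i ω).1 (Fin.castSucc h)) ((Z i ω).2 h)
      ((Z i ω).1 h.succ) = 0} = 0 := by
  classical
  -- The indicator of having seen a null transition is a supermartingale that starts at `0`.
  have := hZ.ville (fun t D => if ∃ i, ∃ h, p h ((D i).1 (Fin.castSucc h)) ((D i).2 h)
      ((D i).1 h.succ) = 0 then 1 else 0) (fun t D => by split_ifs <;> simp) ?_ one_pos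
  · refine le_antisymm ?_ MeasureTheory.measureReal_nonneg
    simp only [IsEmpty.exists_iff, if_false, zero_div] at this
    refine le_trans (MeasureTheory.measureReal_mono ?_) this
    rintro ω ⟨t, i, hi, h, h0⟩
    refine ⟨t, ?_⟩
    rw [if_pos ⟨⟨i, hi⟩, h, h0⟩]
  · intro t D
    split_ifs with hD
    · refine le_trans (episodeMean_mono hp _ _ (G := fun _ => 1) fun e => ?_)
        (episodeMean_const hp _ _ _).le
      split_ifs <;> simp
    · refine (Finset.sum_eq_zero fun e _ => ?_).le
      by_cases he : episodeProb p (alg.policy t D) s₁ e = 0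
      · rw [he, zero_mul]
      · dsimp only
        rw [if_neg, mul_zero]
        rintro ⟨i, h, h0⟩
        revert h0
        refine Fin.lastCases ?_ (fun j => ?_) i
        · simpa using transition_ne_zero_of_episodeProb_ne_zero he h
        · simpa using fun h0 => hD ⟨j, h, h0⟩

end Ville

/-! ### The mixture likelihood ratio and the KL confidence regions. -/

section Mixture

variable {S : Type*} [Fintype S] [DecidableEq S]

/-- The likelihood ratio, for data with counts `k`, of the uniform mixture of all probability
vectors and `q`. -/
def mixtureRatio (q : S → ℝ) (k : S → ℕ) : ℝ :=
  ((Fintype.card S - 1).factorial * ∏ s, ((k s).factorial : ℝ)) /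
    ((∑ s, k s + (Fintype.card S - 1)).factorial * ∏ s, q s ^ k s)

lemma mixtureRatio_nonneg {q : S → ℝ} (hq : ∀ s, 0 ≤ q s) (k : S → ℕ) :
    0 ≤ mixtureRatio q k := by
  have : 0 ≤ ∏ s, q s ^ k s := Finset.prod_nonneg fun s _ => pow_nonneg (hq s) _
  unfold mixtureRatio
  positivity

lemma mixtureRatio_zero (q : S → ℝ) : mixtureRatio q (fun _ => 0) = 1 := by
  simp [mixtureRatio, Nat.factorial_ne_zero]

/-- One more observation of `s` multiplies the mixture likelihood by Laplace's predictive
probability `(k s + 1) / (n + S)`, and the likelihood of `q` by `q s`. -/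
lemma mixtureRatio_add_single (q : S → ℝ) (k : S → ℕ) (s : S) :
    mixtureRatio q (fun x => k x + if s = x then 1 else 0) =
      mixtureRatio q k * ((k s + 1) / ((∑ x, k x : ℕ) + Fintype.card S) / q s) := by
  have hS : 0 < Fintype.card S := Fintype.card_pos_iff.2 ⟨s⟩
  have h1 : ∏ x, ((k x + if s = x then 1 else 0).factorial : ℝ) =
      (∏ x, ((k x).factorial : ℝ)) * (k s + 1) := by
    have : ∀ x, ((k x + if s = x then 1 else 0).factorial : ℝ) =
        (k x).factorial * if s = x then (k x + 1 : ℝ) else 1 := by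
      intro x
      split_ifs
      · rw [Nat.factorial_succ]
        push_cast
        ring
      · simp
    simp_rw [this, Finset.prod_mul_distrib, Finset.prod_ite_eq, Finset.mem_univ, if_true]
  have h2 : ∏ x, q x ^ (k x + if s = x then 1 else 0) = (∏ x, q x ^ k x) * q s := by
    simp_rw [pow_add, Finset.prod_mul_distrib]
    congr 1
    rw [Finset.prod_eq_single s] <;> simp +contextual [eq_comm]
  have h3 : (∑ x, (k x + if s = x then 1 else 0)) + (Fintype.card S - 1) =
      (∑ x, k x + (Fintype.card S - 1)) + 1 := by
    rw [Finset.sum_add_distrib]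
    simp
    ring
  have h4 : ((∑ x, k x + (Fintype.card S - 1) + 1 : ℕ) : ℝ) = (∑ x, k x : ℕ) + Fintype.card S := by
    rw [add_assoc, Nat.sub_add_cancel hS]
    push_cast
    ring
  unfold mixtureRatio
  rw [h1, h2, h3, Nat.factorial_succ, Nat.cast_mul, h4]
  simp only [div_eq_mul_inv, mul_inv]
  ring

/-- The predictive probabilities sum to `1`. Only an inequality holds, because states with `q s = 0`
contribute nothing on the left. -/
lemma sum_mul_mixtureRatio_le {q : S → ℝ} (hq : q ∈ stdSimplex ℝ S) (k : S → ℕ) :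
    ∑ s, q s * mixtureRatio q (fun x => k x + if s = x then 1 else 0) ≤ mixtureRatio q k := by
  have hS : Nonempty S := by
    by_contra h
    rw [not_nonempty_iff] at h
    simpa using hq.2
  have hpos : (0 : ℝ) < (∑ x, k x : ℕ) + Fintype.card S := by
    have : (0 : ℝ) < Fintype.card S := by exact_mod_cast Fintype.card_pos
    positivity
  have hk : ∀ s, q s * mixtureRatio q (fun x => k x + if s = x then 1 else 0) ≤
      mixtureRatio q k * ((k s + 1) / ((∑ x, k x : ℕ) + Fintype.card S)) := by
    intro s
    have hM := mixtureRatio_nonneg hq.1 k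
    rw [mixtureRatio_add_single]
    rcases (hq.1 s).eq_or_lt with h0 | h0
    · rw [← h0, zero_mul]
      positivity
    · refine le_of_eq ?_
      field_simp
  refine (Finset.sum_le_sum fun s _ => hk s).trans_eq ?_
  rw [← Finset.mul_sum, ← Finset.sum_div, Finset.sum_add_distrib]
  simp only [Finset.sum_const, Finset.card_univ, nsmul_eq_mul, mul_one]
  push_cast at hpos ⊢
  rw [div_self hpos.ne', mul_one]

/-- The left side is the probability that `n` independent draws from `k / n` have counts `k`: one
term in the multinomial expansion of `1 ^ n`. -/
lemma multinomial_mul_prod_le_one {k : S → ℕ} (hk : 0 < ∑ s, k s) :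
    ((∑ s, k s).factorial : ℝ) / (∏ s, ((k s).factorial : ℝ)) *
      ∏ s, ((k s : ℝ) / (∑ x, k x : ℕ)) ^ k s ≤ 1 := by
  set n := ∑ s, k s with hn
  have hn0 : (n : ℝ) ≠ 0 := by exact_mod_cast hk.ne'
  have hsum : ∑ s, (k s : ℝ) / (n : ℝ) = 1 := by
    rw [← Finset.sum_div, ← Nat.cast_sum, ← hn, div_self hn0]
  have hspec : (n.factorial : ℝ) / (∏ s, ((k s).factorial : ℝ)) =
      Nat.multinomial Finset.univ k := by
    rw [div_eq_iff (Finset.prod_ne_zero_iff.2 fun s _ => by positivity), mul_comm]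
    exact_mod_cast (Nat.multinomial_spec Finset.univ k).symm
  have := Finset.sum_pow_eq_sum_piAntidiag (Finset.univ : Finset S)
    (fun s => (k s : ℝ) / (n : ℝ)) n
  rw [hsum, one_pow] at this
  rw [hspec, this]
  refine Finset.single_le_sum (f := fun k' : S → ℕ => (Nat.multinomial Finset.univ k' : ℝ) *
    ∏ s, ((k s : ℝ) / (n : ℝ)) ^ k' s) (fun k' _ => by positivity) ?_
  simp [Finset.mem_piAntidiag, hn]

/-- Combine `(n + m).choose m ≤ (n + m) ^ m / m!` with `m ^ m / m! ≤ e ^ m`. -/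
lemma log_choose_add_le (n m : ℕ) :
    Real.log ((n + m).choose m : ℝ) ≤ m * Real.log (Real.exp 1 * (1 + (n : ℝ) / m)) := by
  rcases m.eq_zero_or_pos with rfl | hm
  · simp
  have hm' : (0 : ℝ) < m := by exact_mod_cast hm
  rw [← Real.log_pow]
  refine Real.log_le_log (by exact_mod_cast Nat.choose_pos (by omega)) ?_
  have h1 : ((n + m).choose m : ℝ) ≤ ((n + m : ℕ) : ℝ) ^ m / m.factorial := Nat.choose_le_pow_div _ _
  have h2 := Real.pow_div_factorial_le_exp (m : ℝ) hm'.le m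
  have h3 : 1 + (n : ℝ) / m = ((n + m : ℕ) : ℝ) / m := by
    push_cast
    field_simp
    ring
  rw [h3, mul_pow, ← Real.exp_nat_mul, mul_one, div_pow]
  refine h1.trans ?_
  calc ((n + m : ℕ) : ℝ) ^ m / m.factorial
      = (m : ℝ) ^ m / m.factorial * (((n + m : ℕ) : ℝ) ^ m / (m : ℝ) ^ m) := by
        field_simp
    _ ≤ _ := by gcongr

/-- `n · KL` is the log likelihood ratio of the empirical distribution and `q`. The maximised
likelihood exceeds the mixture likelihood by at most the factor `(n + S - 1).choose (S - 1)`. The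
hypothesis `hqk` cannot be dropped: an observed null state makes the denominator of `mixtureRatio`
zero, hence the ratio `0`, while the divergence is `⊤`. -/
lemma kl_le_of_mixtureRatio_le {q : S → ℝ} (hq : ∀ s, 0 ≤ q s) {k : S → ℕ}
    (hqk : ∀ s, q s = 0 → k s = 0) (hk : 0 < ∑ s, k s) {c : ℝ} (hc : mixtureRatio q k ≤ c) :
    kl (fun s => (k s : ℝ) / (∑ x, k x : ℕ)) q ≤
      (((Real.log c + ((Fintype.card S : ℝ) - 1) * Real.log (Real.exp 1 *
        (1 + (∑ x, k x : ℕ) / ((Fintype.card S : ℝ) - 1)))) / (∑ x, k x : ℕ) : ℝ) : EReal) := by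
  have hS : 0 < Fintype.card S := by
    rw [Fintype.card_pos_iff]
    by_contra h
    rw [not_nonempty_iff] at h
    simp at hk
  unfold kl
  rw [if_pos fun s hs => by simp [hqk s hs]]
  refine EReal.coe_le_coe_iff.2 ?_
  have hmcast : ((Fintype.card S : ℝ) - 1) = ((Fintype.card S - 1 : ℕ) : ℝ) := by
    rw [Nat.cast_sub hS, Nat.cast_one]
  rw [hmcast]
  have hmult := multinomial_mul_prod_le_one hk
  unfold mixtureRatio at hc
  set m := Fintype.card S - 1
  set n := ∑ x, k x with hn
  have hn0 : (0 : ℝ) < n := by exact_mod_cast hk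
  have hQ : 0 < ∏ s, q s ^ k s := Finset.prod_pos fun s _ => by
    rcases (hq s).eq_or_lt with h | h
    · simp [hqk s h.symm]
    · positivity
  have hP : 0 < ∏ s, ((k s : ℝ) / n) ^ k s := Finset.prod_pos fun s _ => by
    rcases (k s).eq_zero_or_pos with h | h
    · simp [h]
    · positivity
  have hlog : ∑ s, (k s : ℝ) / n * Real.log ((k s : ℝ) / n / q s) =
      Real.log ((∏ s, ((k s : ℝ) / n) ^ k s) / ∏ s, q s ^ k s) / n := by
    rw [← Finset.prod_div_distrib, Real.log_prod, Finset.sum_div]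
    · refine Finset.sum_congr rfl fun s _ => ?_
      rw [← div_pow, Real.log_pow]
      ring
    · intro s hs
      exact div_ne_zero (Finset.prod_ne_zero_iff.1 hP.ne' s hs)
        (Finset.prod_ne_zero_iff.1 hQ.ne' s hs)
  rw [hlog]
  gcongr
  have hF : (0 : ℝ) < ∏ s, ((k s).factorial : ℝ) := Finset.prod_pos fun s _ => by positivity
  set P := ∏ s, ((k s : ℝ) / n) ^ k s
  set Q := ∏ s, q s ^ k s
  set F := ∏ s, ((k s).factorial : ℝ)
  have hC : (0 : ℝ) < (n + m).choose m := by exact_mod_cast Nat.choose_pos (by omega)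
  have hfac : ((n + m).choose m : ℝ) * (m.factorial * n.factorial) = (n + m).factorial := by
    have := Nat.add_choose_mul_factorial_mul_factorial n m
    rw [← this]
    push_cast
    ring
  have hc0 : 0 < c := lt_of_lt_of_le (by positivity) hc
  have hPQ : P / Q ≤ c * (n + m).choose m := by
    calc P / Q = (m.factorial * F / ((n + m).factorial * Q)) * (n + m).choose m *
          (n.factorial / F * P) := by
          rw [← hfac]
          field_simp
      _ ≤ c * (n + m).choose m * 1 := by gcongr
      _ = _ := mul_one _
  calc Real.log (P / Q) ≤ Real.log (c * (n + m).choose m) := Real.log_le_log (by positivity) hPQ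
    _ = Real.log c + Real.log ((n + m).choose m) := Real.log_mul hc0.ne' hC.ne'
    _ ≤ _ := by gcongr; exact log_choose_add_le n m

end Mixture

/-! ### The regular event has probability at least `1 - δ`. -/

section Concentration

variable {S A : Type*} [Fintype S] [Fintype A] [DecidableEq S] [DecidableEq A] {H : ℕ}

lemma count_snoc {t : ℕ} (D : History S A H t) (e : Episode S A H) (h : Fin H) (s : S) (a : A) :
    count (Fin.snoc (α := fun _ => Episode S A H) D e) h s a =
      count D h s a + if e.1 h.castSucc = s ∧ e.2 h = a then 1 else 0 := by
  unfold count
  rw [Finset.card_filter, Finset.card_filter, Fin.sum_univ_castSucc]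
  simp only [Fin.snoc_castSucc, Fin.snoc_last]

lemma countNext_snoc {t : ℕ} (D : History S A H t) (e : Episode S A H) (h : Fin H) (s : S)
    (a : A) (s' : S) :
    countNext (Fin.snoc (α := fun _ => Episode S A H) D e) h s a s' =
      countNext D h s a s' +
        if e.1 h.castSucc = s ∧ e.2 h = a ∧ e.1 h.succ = s' then 1 else 0 := by
  unfold countNext
  rw [Finset.card_filter, Finset.card_filter, Fin.sum_univ_castSucc]
  simp only [Fin.snoc_castSucc, Fin.snoc_last]

lemma sum_countNext {t : ℕ} (D : History S A H t) (h : Fin H) (s : S) (a : A) :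
    ∑ s', countNext D h s a s' = count D h s a := by
  unfold count countNext
  simp_rw [Finset.card_filter]
  rw [Finset.sum_comm]
  refine Finset.sum_congr rfl fun i _ => ?_
  by_cases h1 : (D i).1 h.castSucc = s <;> by_cases h2 : (D i).2 h = a <;> simp [h1, h2]

lemma count_le {t : ℕ} (D : History S A H t) (h : Fin H) (s : S) (a : A) : count D h s a ≤ t :=
  (Finset.card_filter_le _ _).trans_eq (by simp)

/-- The expected number of visits of `(s, a)` in step `h`, given the policies played. -/
def pseudoCount (alg : Algorithm S A H) (p : Fin H → S → A → S → ℝ) (s₁ : S) (h : Fin H)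
    (s : S) (a : A) : (t : ℕ) → History S A H t → ℝ
  | 0, _ => 0
  | t + 1, D => pseudoCount alg p s₁ h s a t (Fin.init D) +
      occupancy p (alg.policy t (Fin.init D)) s₁ h s a

variable {Ω : Type*} {alg : Algorithm S A H} {p : Fin H → S → A → S → ℝ} {s₁ : S}
  {Z : ℕ → Ω → Episode S A H}

lemma pseudoCount_historyOf (t : ℕ) (ω : Ω) (h : Fin H) (s : S) (a : A) :
    pseudoCount alg p s₁ h s a t (historyOf Z t ω) =
      ∑ i ∈ Finset.range t, occupancy p (alg.policy i (historyOf Z i ω)) s₁ h s a := by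
  induction t with
  | zero => simp [pseudoCount]
  | succ t ih =>
    rw [Finset.sum_range_succ, ← ih]
    rfl

/-- All confidence regions contain the transition probabilities, and no count is much smaller than
its conditional expectation. -/
def IsRegular (alg : Algorithm S A H) (p : Fin H → S → A → S → ℝ) (s₁ : S) (δ : ℝ)
    (Z : ℕ → Ω → Episode S A H) (ω : Ω) : Prop :=
  ∀ t h s a, p h s a ∈ confRegion δ (historyOf Z t ω) h s a ∧
    pseudoCount alg p s₁ h s a t (historyOf Z t ω) / 2 -
      Real.log (2 * Fintype.card S * Fintype.card A * H / δ) ≤ count (historyOf Z t ω) h s a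

variable [MeasurableSpace Ω] {μ : MeasureTheory.Measure Ω}
  [MeasureTheory.IsProbabilityMeasure μ]

lemma IsRun.real_mixtureRatio_ge (hp : ∀ h s a, p h s a ∈ stdSimplex ℝ S)
    (hZ : IsRun μ alg p s₁ Z) (h : Fin H) (s : S) (a : A) {c : ℝ} (hc : 0 < c) :
    μ.real {ω | ∃ t, c ≤ mixtureRatio (p h s a) (countNext (historyOf Z t ω) h s a)} ≤ 1 / c := by
  have := hZ.ville (fun t D => mixtureRatio (p h s a) (countNext D h s a))
    (fun t D => mixtureRatio_nonneg (hp h s a).1 _) ?_ hc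
  · refine this.trans_eq ?_
    have h0 : countNext (fun i : Fin 0 => (i.elim0 : Episode S A H)) h s a = fun _ => 0 := by
      funext s'
      simp [countNext]
    simp only [h0, mixtureRatio_zero]
  · intro t D
    set k := countNext D h s a with hk
    set g : S → A → S → ℝ := fun u b s' => if u = s ∧ b = a then
      mixtureRatio (p h s a) (fun x => k x + if s' = x then 1 else 0)
      else mixtureRatio (p h s a) k with hg
    have h1 : ∀ e : Episode S A H, mixtureRatio (p h s a)
        (countNext (Fin.snoc (α := fun _ => Episode S A H) D e) h s a) =
        g (e.1 h.castSucc) (e.2 h) (e.1 h.succ) := by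
      intro e
      have : countNext (Fin.snoc (α := fun _ => Episode S A H) D e) h s a = fun x => k x +
          if e.1 h.castSucc = s ∧ e.2 h = a ∧ e.1 h.succ = x then 1 else 0 :=
        funext fun x => countNext_snoc D e h s a x
      rw [this]
      by_cases h1 : e.1 h.castSucc = s <;> by_cases h2 : e.2 h = a <;> simp [h1, h2, hg]
    simp_rw [h1]
    rw [episodeMean_transition hp]
    refine le_trans (episodeMean_mono hp _ _ (G := fun _ => mixtureRatio (p h s a) k) fun e => ?_)
      (episodeMean_const hp _ _ _).le
    by_cases he : e.1 h.castSucc = s ∧ e.2 h = a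
    · simp only [hg, he, and_self, if_true]
      exact sum_mul_mixtureRatio_le (hp h s a) k
    · simp only [hg, he, if_false]
      rw [← Finset.sum_mul, (hp h _ _).2, one_mul]

/-- Multiplicative lower-tail bound: `exp (pseudoCount / 2 - count)` is a supermartingale that
starts at `1`. -/
lemma IsRun.real_pseudoCount_ge (hp : ∀ h s a, p h s a ∈ stdSimplex ℝ S)
    (hZ : IsRun μ alg p s₁ Z) (h : Fin H) (s : S) (a : A) (L : ℝ) :
    μ.real {ω | ∃ t, L ≤ pseudoCount alg p s₁ h s a t (historyOf Z t ω) / 2 -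
      count (historyOf Z t ω) h s a} ≤ 1 / Real.exp L := by
  have := hZ.ville (fun t D => Real.exp (pseudoCount alg p s₁ h s a t D / 2 - count D h s a))
    (fun t D => (Real.exp_pos _).le) ?_ (Real.exp_pos L)
  · simp only [Real.exp_le_exp] at this
    refine this.trans_eq ?_
    simp [pseudoCount, count]
  · intro t D
    set x := occupancy p (alg.policy t D) s₁ h s a with hx
    set c := Real.exp (pseudoCount alg p s₁ h s a t D / 2 - count D h s a) with hc
    have h1 : ∀ e : Episode S A H,
        Real.exp (pseudoCount alg p s₁ h s a (t + 1)
          (Fin.snoc (α := fun _ => Episode S A H) D e) / 2 -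
            (count (Fin.snoc (α := fun _ => Episode S A H) D e) h s a : ℕ)) =
        c * Real.exp (x / 2) + c * Real.exp (x / 2) * (Real.exp (-1) - 1) *
          (if e.1 h.castSucc = s ∧ e.2 h = a then 1 else 0) := by
      intro e
      rw [count_snoc, pseudoCount, Fin.init_snoc, ← hx, hc]
      have : ∀ y z : ℝ, (y + x) / 2 - z = (y / 2 - z) + x / 2 := fun y z => by ring
      split_ifs
      · rw [Nat.cast_add, Nat.cast_one, this, sub_add_eq_sub_sub, sub_eq_add_neg _ (1 : ℝ),
          Real.exp_add, Real.exp_add]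
        ring
      · rw [add_zero, this, Real.exp_add]
        ring
    simp_rw [h1]
    rw [episodeMean_const_add_mul hp]
    change c * Real.exp (x / 2) + c * Real.exp (x / 2) * (Real.exp (-1) - 1) * x ≤ c
    have hx0 : 0 ≤ x := occupancy_nonneg hp _ _ _ _ _
    have hc0 : 0 < c := Real.exp_pos _
    -- The factor `1/2` in front of `pseudoCount` works because `e⁻¹ < 1/2`: the left side is at
    -- most `1 - x / 2`.
    have h3 : 1 + (Real.exp (-1) - 1) * x ≤ Real.exp (-(x / 2)) := by
      have := Real.add_one_le_exp (-(x / 2))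
      nlinarith [Real.exp_neg_one_lt_half]
    calc c * Real.exp (x / 2) + c * Real.exp (x / 2) * (Real.exp (-1) - 1) * x
        = c * Real.exp (x / 2) * (1 + (Real.exp (-1) - 1) * x) := by ring
      _ ≤ c * Real.exp (x / 2) * Real.exp (-(x / 2)) := by gcongr
      _ = c := by rw [mul_assoc, ← Real.exp_add]; simp

lemma mem_confRegion {δ : ℝ} {t : ℕ} {D : History S A H t} {h : Fin H} {s : S} {a : A}
    {q : S → ℝ} (hq : q ∈ stdSimplex ℝ S) (hqD : ∀ s', q s' = 0 → countNext D h s a s' = 0)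
    (hM : mixtureRatio q (countNext D h s a) ≤ 2 * Fintype.card S * Fintype.card A * H / δ) :
    q ∈ confRegion δ D h s a := by
  refine ⟨hq, ?_⟩
  unfold radius empirical
  by_cases h0 : count D h s a = 0
  · simp [h0]
  · simp only [h0, if_false]
    have := kl_le_of_mixtureRatio_le hq.1 hqD
      (by rw [sum_countNext]; exact Nat.pos_of_ne_zero h0) hM
    rw [sum_countNext] at this
    exact this

theorem IsRun.one_sub_le_real_isRegular (hp : ∀ h s a, p h s a ∈ stdSimplex ℝ S)
    (hZ : IsRun μ alg p s₁ Z) {δ : ℝ} (hδ : 0 < δ) (hH : 0 < H) (hA : 0 < Fintype.card A) :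
    1 - δ ≤ μ.real {ω | IsRegular alg p s₁ δ Z ω} := by
  have hS : 0 < Fintype.card S := Fintype.card_pos_iff.2 ⟨s₁⟩
  set c : ℝ := 2 * Fintype.card S * Fintype.card A * H / δ with hc
  have hc0 : 0 < c := by positivity
  set N : Set Ω := {ω | ∃ t, ∃ i < t, ∃ h, p h ((Z i ω).1 (Fin.castSucc h)) ((Z i ω).2 h)
      ((Z i ω).1 h.succ) = 0} with hN
  set E : Fin H × S × A → Set Ω := fun x =>
    {ω | ∃ t, c ≤ mixtureRatio (p x.1 x.2.1 x.2.2) (countNext (historyOf Z t ω) x.1 x.2.1 x.2.2)}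
      with hE
  set F : Fin H × S × A → Set Ω := fun x =>
    {ω | ∃ t, Real.log c ≤ pseudoCount alg p s₁ x.1 x.2.1 x.2.2 t (historyOf Z t ω) / 2 -
      count (historyOf Z t ω) x.1 x.2.1 x.2.2} with hF
  have hsub : {ω | IsRegular alg p s₁ δ Z ω}ᶜ ⊆ N ∪ ⋃ x, (E x ∪ F x) := by
    intro ω hω
    by_contra hcon
    apply hω
    simp only [Set.mem_union, Set.mem_iUnion, not_or, not_exists] at hcon
    obtain ⟨hωN, hωEF⟩ := hcon
    intro t h s a
    obtain ⟨hωE, hωF⟩ := hωEF (h, s, a)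
    constructor
    · refine mem_confRegion (hp h s a) (fun s' hs' => ?_) ?_
      · by_contra hne
        obtain ⟨i, hi⟩ := Finset.card_pos.1 (Nat.pos_of_ne_zero hne)
        obtain ⟨-, h1, h2, h3⟩ := Finset.mem_filter.1 hi
        refine hωN ⟨t, i, i.2, h, ?_⟩
        simp only [historyOf] at h1 h2 h3
        rw [h1, h2, h3, hs']
      · by_contra hlt
        exact hωE ⟨t, (not_le.1 hlt).le⟩
    · by_contra hlt
      refine hωF ⟨t, ?_⟩
      dsimp only
      linarith
  have hbound : μ.real {ω | IsRegular alg p s₁ δ Z ω}ᶜ ≤ δ := by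
    calc _ ≤ _ := MeasureTheory.measureReal_mono hsub
      _ ≤ μ.real N + μ.real (⋃ x, (E x ∪ F x)) := MeasureTheory.measureReal_union_le _ _
      _ ≤ 0 + ∑ x, μ.real (E x ∪ F x) := by
          gcongr
          · exact (hZ.real_null_transition hp).le
          · exact MeasureTheory.measureReal_iUnion_fintype_le _
      -- Two bad events for each of the `SAH` triples, each of probability at most `1 / c = δ /
      -- (2SAH)`; null transitions cost nothing.
      _ ≤ 0 + ∑ x : Fin H × S × A, (1 / c + 1 / c) := by
          gcongr with x
          refine (MeasureTheory.measureReal_union_le _ _).trans (add_le_add ?_ ?_)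
          · exact hZ.real_mixtureRatio_ge hp _ _ _ hc0
          · refine (hZ.real_pseudoCount_ge hp _ _ _ _).trans_eq ?_
            rw [Real.exp_log hc0]
      _ = δ := by
          simp only [Finset.sum_const, Finset.card_univ, Fintype.card_prod, Fintype.card_fin,
            nsmul_eq_mul, hc]
          push_cast
          field_simp
          ring
  -- Subadditivity replaces the complement formula, so measurability of the regular event plays no
  -- role.
  have h1 := MeasureTheory.measureReal_union_le (μ := μ) {ω | IsRegular alg p s₁ δ Z ω}
    {ω | IsRegular alg p s₁ δ Z ω}ᶜ
  rw [Set.union_compl_self, MeasureTheory.probReal_univ] at h1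
  linarith

end Concentration

/-! ### From KL balls to differences of expectations. -/

section Deviation

variable {S : Type*} [Fintype S] [DecidableEq S]

/-- A form of Pinsker's inequality, with a constant that the Hellinger distance provides. -/
lemma sq_sum_abs_sub_le_of_kl_le {p q : S → ℝ} (hp : p ∈ stdSimplex ℝ S)
    (hq : q ∈ stdSimplex ℝ S) {x : ℝ} (h : kl p q ≤ (x : EReal)) :
    (∑ s, |p s - q s|) ^ 2 ≤ 4 * x := by
  unfold kl at h
  split_ifs at h with hac
  swap
  · exact absurd (top_le_iff.1 h) (EReal.coe_ne_top x)
  rw [EReal.coe_le_coe_iff] at h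
  -- `log y ≤ y - 1` at `y = √(q s / p s)`; summed over `s`, it bounds the squared Hellinger
  -- distance by KL.
  have hterm : ∀ s, 2 * p s - 2 * (√(p s) * √(q s)) ≤ p s * Real.log (p s / q s) := by
    intro s
    rcases (hp.1 s).eq_or_lt with h0 | h0
    · simp [← h0]
    have hq0 : 0 < q s := lt_of_le_of_ne (hq.1 s) fun h1 => h0.ne' (hac s h1.symm)
    have ha := Real.sqrt_pos.2 h0
    have hb := Real.sqrt_pos.2 hq0
    have hpa := Real.sq_sqrt h0.le
    have hqb := Real.sq_sqrt hq0.le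
    set a := √(p s)
    set b := √(q s)
    rw [← hpa, ← hqb, ← div_pow, Real.log_pow, ← inv_div b a, Real.log_inv]
    have h1 := Real.log_le_sub_one_of_pos (div_pos hb ha)
    have h2 : a ^ 2 * (b / a) = a * b := by field_simp
    push_cast
    nlinarith [mul_le_mul_of_nonneg_left h1 (sq_nonneg a)]
  have hell : ∑ s, (√(p s) - √(q s)) ^ 2 ≤ x := by
    refine le_trans (le_of_eq ?_) ((Finset.sum_le_sum fun s _ => hterm s).trans h)
    have h1 : ∀ s, (√(p s) - √(q s)) ^ 2 = p s + q s - 2 * (√(p s) * √(q s)) := by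
      intro s
      rw [sub_sq, Real.sq_sqrt (hp.1 s), Real.sq_sqrt (hq.1 s)]
      ring
    simp_rw [h1, Finset.sum_sub_distrib, Finset.sum_add_distrib, ← Finset.mul_sum]
    rw [hp.2, hq.2]
    ring
  have hplus : ∑ s, (√(p s) + √(q s)) ^ 2 ≤ 4 := by
    have h1 : ∀ s, (√(p s) + √(q s)) ^ 2 ≤ 2 * p s + 2 * q s := by
      intro s
      nlinarith [Real.sq_sqrt (hp.1 s), Real.sq_sqrt (hq.1 s), sq_nonneg (√(p s) - √(q s))]
    refine (Finset.sum_le_sum fun s _ => h1 s).trans_eq ?_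
    simp_rw [Finset.sum_add_distrib, ← Finset.mul_sum]
    rw [hp.2, hq.2]
    norm_num
  -- This factorisation and Cauchy–Schwarz compare the `ℓ¹` distance with the Hellinger distance.
  have habs : ∀ s, |p s - q s| = |√(p s) - √(q s)| * (√(p s) + √(q s)) := by
    intro s
    rw [← abs_of_nonneg (add_nonneg (Real.sqrt_nonneg (p s)) (Real.sqrt_nonneg (q s))), ← abs_mul]
    congr 1
    nlinarith [Real.sq_sqrt (hp.1 s), Real.sq_sqrt (hq.1 s)]
  simp_rw [habs]
  refine (Finset.sum_mul_sq_le_sq_mul_sq _ _ _).trans ?_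
  simp_rw [sq_abs]
  have h0 : 0 ≤ ∑ s, (√(p s) - √(q s)) ^ 2 := Finset.sum_nonneg fun s _ => sq_nonneg _
  calc _ ≤ (∑ s, (√(p s) - √(q s)) ^ 2) * 4 := by gcongr
    _ ≤ x * 4 := by gcongr
    _ = _ := mul_comm _ _

lemma sum_mul_mem_Icc {q : S → ℝ} (hq : q ∈ stdSimplex ℝ S) {W : S → ℝ} {M : ℝ}
    (hW : ∀ s, W s ∈ Set.Icc 0 M) : ∑ s, q s * W s ∈ Set.Icc 0 M := by
  refine ⟨Finset.sum_nonneg fun s _ => mul_nonneg (hq.1 s) (hW s).1, ?_⟩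
  calc ∑ s, q s * W s ≤ ∑ s, q s * M :=
        Finset.sum_le_sum fun s _ => mul_le_mul_of_nonneg_left (hW s).2 (hq.1 s)
    _ = M := by rw [← Finset.sum_mul, hq.2, one_mul]

/-- As `p` and `q` have equal mass, `W` may be centred at `M / 2`. -/
lemma abs_sum_mul_sub_sum_mul_le {p q : S → ℝ} (hp : p ∈ stdSimplex ℝ S)
    (hq : q ∈ stdSimplex ℝ S) {W : S → ℝ} {M : ℝ} (hW : ∀ s, W s ∈ Set.Icc 0 M) :
    |∑ s, q s * W s - ∑ s, p s * W s| ≤ M / 2 * ∑ s, |q s - p s| := by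
  have h1 : ∑ s, q s * W s - ∑ s, p s * W s = ∑ s, (q s - p s) * (W s - M / 2) := by
    simp_rw [sub_mul, mul_sub, Finset.sum_sub_distrib, ← Finset.sum_mul]
    rw [hp.2, hq.2]
    ring
  rw [h1, Finset.mul_sum]
  refine (Finset.abs_sum_le_sum_abs _ _).trans (Finset.sum_le_sum fun s _ => ?_)
  rw [abs_mul, mul_comm]
  gcongr
  rw [abs_le]
  constructor <;> linarith [(hW s).1, (hW s).2]

end Deviation

/-! ### Validity and width of the confidence bounds. -/

section Bounds

variable {S A : Type*} [Fintype S] [Fintype A] [DecidableEq S] [DecidableEq A] {H : ℕ}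

lemma empirical_mem_stdSimplex [Nonempty S] {t : ℕ} (D : History S A H t) (h : Fin H) (s : S)
    (a : A) : empirical D h s a ∈ stdSimplex ℝ S := by
  constructor
  · intro s'
    unfold empirical
    split_ifs <;> positivity
  · unfold empirical
    split_ifs with h0
    · simp
    · rw [← Finset.sum_div, ← Nat.cast_sum, sum_countNext, div_self (by exact_mod_cast h0)]

/-- The square root of the confidence radius, truncated at `1`. -/
def width (nS nA H : ℕ) (δ : ℝ) (n : ℕ) : ℝ :=
  if n = 0 then 1 else min 1 √(threshold nS nA H δ n / n)

/-- Each of `p`, `q` is within `ℓ¹` distance `2 √(β / n)` of the empirical vector, and the dual norm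
contributes `M / 2`. The truncation at `1` is the trivial bound. -/
lemma abs_sum_mul_sub_le_width [Nonempty S] {δ : ℝ} {t : ℕ} {D : History S A H t} {h : Fin H}
    {s : S} {a : A} {p q : S → ℝ} (hp : p ∈ confRegion δ D h s a)
    (hq : q ∈ confRegion δ D h s a) {W : S → ℝ} {M : ℝ} (hW : ∀ s, W s ∈ Set.Icc 0 M) :
    |∑ s, q s * W s - ∑ s, p s * W s| ≤
      2 * M * width (Fintype.card S) (Fintype.card A) H δ (count D h s a) := by
  have hM : 0 ≤ M := (hW s).1.trans (hW s).2
  have htriv : |∑ s, q s * W s - ∑ s, p s * W s| ≤ 2 * M * 1 := by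
    have h1 := sum_mul_mem_Icc hp.1 hW
    have h2 := sum_mul_mem_Icc hq.1 hW
    rw [abs_le]
    constructor <;> linarith [h1.1, h1.2, h2.1, h2.2]
  unfold width
  split_ifs with h0
  · exact htriv
  rw [mul_min_of_nonneg _ _ (by positivity)]
  refine le_min htriv ((abs_sum_mul_sub_sum_mul_le hp.1 hq.1 hW).trans ?_)
  have hemp := empirical_mem_stdSimplex D h s a
  have hdist : ∀ q ∈ confRegion δ D h s a, ∑ s', |empirical D h s a s' - q s'| ≤
      2 * √(threshold (Fintype.card S) (Fintype.card A) H δ (count D h s a) /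
        (count D h s a : ℝ)) := by
    intro q hq
    have h1 := hq.2
    rw [radius, if_neg h0] at h1
    have h2 := sq_sum_abs_sub_le_of_kl_le hemp hq.1 h1
    have h3 := Real.le_sqrt_of_sq_le h2
    rwa [Real.sqrt_mul (by norm_num), show √(4 : ℝ) = 2 by
      rw [show (4 : ℝ) = 2 ^ 2 by norm_num, Real.sqrt_sq (by norm_num)]] at h3
  have htri : ∑ s', |q s' - p s'| ≤ ∑ s', |empirical D h s a s' - q s'| +
      ∑ s', |empirical D h s a s' - p s'| := by
    rw [← Finset.sum_add_distrib]
    refine Finset.sum_le_sum fun s' _ => ?_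
    rw [abs_sub_comm (empirical D h s a s') (q s')]
    exact abs_sub_le _ _ _
  nlinarith [mul_le_mul_of_nonneg_left (htri.trans (add_le_add (hdist q hq) (hdist p hp)))
    (div_nonneg hM zero_le_two)]

variable {γ δ : ℝ} {r : Fin H → S → A → ℝ} {t : ℕ} {D : History S A H t}

lemma upperV_last (γ δ : ℝ) (r : Fin H → S → A → ℝ) (D : History S A H t) (s : S) :
    upperV γ δ r D (Fin.last H) s = 0 := by
  simp [upperV]

lemma lowerV_last (γ δ : ℝ) (r : Fin H → S → A → ℝ) (D : History S A H t) (s : S) :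
    lowerV γ δ r D (Fin.last H) s = 0 := by
  simp [lowerV]

lemma upperV_castSucc (γ δ : ℝ) (r : Fin H → S → A → ℝ) (D : History S A H t) (h : Fin H)
    (s : S) : upperV γ δ r D h.castSucc s = ⨆ a, upperQ γ δ r D h s a := by
  simp [upperV, upperQ]

lemma lowerV_castSucc (γ δ : ℝ) (r : Fin H → S → A → ℝ) (D : History S A H t) (h : Fin H)
    (s : S) : lowerV γ δ r D h.castSucc s = ⨆ a, lowerQ γ δ r D h s a := by
  simp [lowerV, lowerQ]

lemma upperQ_le_upperV (γ δ : ℝ) (r : Fin H → S → A → ℝ) (D : History S A H t) (h : Fin H)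
    (s : S) (a : A) : upperQ γ δ r D h s a ≤ upperV γ δ r D h.castSucc s := by
  rw [upperV_castSucc]
  exact le_ciSup (Set.finite_range _).bddAbove a

lemma lowerQ_le_lowerV (γ δ : ℝ) (r : Fin H → S → A → ℝ) (D : History S A H t) (h : Fin H)
    (s : S) (a : A) : lowerQ γ δ r D h s a ≤ lowerV γ δ r D h.castSucc s := by
  rw [lowerV_castSucc]
  exact le_ciSup (Set.finite_range _).bddAbove a

lemma upperV_eq_of_isGreedy {π : Policy S A H} (hπ : IsGreedy (upperQ γ δ r D) π) (h : Fin H)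
    (s : S) : upperV γ δ r D h.castSucc s = upperQ γ δ r D h s (π h s) := by
  have : Nonempty A := ⟨π h s⟩
  refine le_antisymm ?_ (upperQ_le_upperV _ _ _ _ _ _ _)
  rw [upperV_castSucc]
  exact ciSup_le fun a => hπ h s a

lemma lowerV_eq_of_isGreedy {π : Policy S A H} (hπ : IsGreedy (lowerQ γ δ r D) π) (h : Fin H)
    (s : S) : lowerV γ δ r D h.castSucc s = lowerQ γ δ r D h s (π h s) := by
  have : Nonempty A := ⟨π h s⟩
  refine le_antisymm ?_ (lowerQ_le_lowerV _ _ _ _ _ _ _)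
  rw [lowerV_castSucc]
  exact ciSup_le fun a => hπ h s a

lemma image_confRegion_subset (δ : ℝ) (D : History S A H t) (h : Fin H) (s : S) (a : A)
    {W : S → ℝ} {M : ℝ} (hW : ∀ s, W s ∈ Set.Icc 0 M) :
    (fun q : S → ℝ => ∑ s', q s' * W s') '' confRegion δ D h s a ⊆ Set.Icc 0 M := by
  rintro _ ⟨q, hq, rfl⟩
  exact sum_mul_mem_Icc hq.1 hW

lemma sigma_succ (γ : ℝ) (n : ℕ) : sigma γ (n + 1) = 1 + γ * sigma γ n := by
  unfold sigma
  rw [Finset.sum_range_succ', Finset.mul_sum, pow_zero, add_comm]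
  congr 1
  exact Finset.sum_congr rfl fun i _ => by ring

lemma sigma_mono (hγ : 0 ≤ γ) : Monotone (sigma γ) := fun _ _ hmn =>
  Finset.sum_le_sum_of_subset_of_nonneg (Finset.range_subset_range.2 hmn)
    fun i _ _ => pow_nonneg hγ i

lemma upperV_mem_Icc_sub [Nonempty A] (hγ : 0 ≤ γ) (hr : ∀ h s a, r h s a ∈ Set.Icc (0 : ℝ) 1)
    (hD : ∀ h s a, (confRegion δ D h s a).Nonempty) (h : Fin (H + 1)) (s : S) :
    upperV γ δ r D h s ∈ Set.Icc 0 (sigma γ (H - h)) := by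
  induction h using Fin.reverseInduction generalizing s with
  | last => simp [upperV_last, sigma]
  | cast h ih =>
    have hsub : H - (h.castSucc : ℕ) = H - (h.succ : ℕ) + 1 := by
      simp only [Fin.val_castSucc, Fin.val_succ]
      omega
    have hQ : ∀ a, upperQ γ δ r D h s a ∈ Set.Icc 0 (sigma γ (H - (h.castSucc : ℕ))) := by
      intro a
      have himg := image_confRegion_subset δ D h s a ih
      have hne := (hD h s a).image fun q : S → ℝ => ∑ s', q s' * upperV γ δ r D h.succ s'
      have h0 : 0 ≤ sSup ((fun q : S → ℝ => ∑ s', q s' * upperV γ δ r D h.succ s') ''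
        confRegion δ D h s a) := Real.sSup_nonneg fun x hx => (himg hx).1
      have h1 := csSup_le hne fun x hx => (himg hx).2
      rw [hsub, sigma_succ]
      unfold upperQ upperBackup
      exact ⟨add_nonneg (hr h s a).1 (mul_nonneg hγ h0),
        add_le_add (hr h s a).2 (mul_le_mul_of_nonneg_left h1 hγ)⟩
    rw [upperV_castSucc]
    exact ⟨Real.iSup_nonneg fun a => (hQ a).1, ciSup_le fun a => (hQ a).2⟩

lemma lowerV_mem_Icc_sub [Nonempty A] (hγ : 0 ≤ γ) (hr : ∀ h s a, r h s a ∈ Set.Icc (0 : ℝ) 1)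
    (hD : ∀ h s a, (confRegion δ D h s a).Nonempty) (h : Fin (H + 1)) (s : S) :
    lowerV γ δ r D h s ∈ Set.Icc 0 (sigma γ (H - h)) := by
  induction h using Fin.reverseInduction generalizing s with
  | last => simp [lowerV_last, sigma]
  | cast h ih =>
    have hsub : H - (h.castSucc : ℕ) = H - (h.succ : ℕ) + 1 := by
      simp only [Fin.val_castSucc, Fin.val_succ]
      omega
    have hQ : ∀ a, lowerQ γ δ r D h s a ∈ Set.Icc 0 (sigma γ (H - (h.castSucc : ℕ))) := by
      intro a
      have himg := image_confRegion_subset δ D h s a ih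
      obtain ⟨x, hx⟩ :=
        (hD h s a).image fun q : S → ℝ => ∑ s', q s' * lowerV γ δ r D h.succ s'
      have h0 : 0 ≤ sInf ((fun q : S → ℝ => ∑ s', q s' * lowerV γ δ r D h.succ s') ''
        confRegion δ D h s a) := Real.sInf_nonneg fun x hx => (himg hx).1
      have h1 := (csInf_le ⟨0, fun y hy => (himg hy).1⟩ hx).trans (himg hx).2
      rw [hsub, sigma_succ]
      unfold lowerQ lowerBackup
      exact ⟨add_nonneg (hr h s a).1 (mul_nonneg hγ h0),
        add_le_add (hr h s a).2 (mul_le_mul_of_nonneg_left h1 hγ)⟩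
    rw [lowerV_castSucc]
    exact ⟨Real.iSup_nonneg fun a => (hQ a).1, ciSup_le fun a => (hQ a).2⟩

lemma upperV_mem_Icc [Nonempty A] (hγ : 0 ≤ γ) (hr : ∀ h s a, r h s a ∈ Set.Icc (0 : ℝ) 1)
    (hD : ∀ h s a, (confRegion δ D h s a).Nonempty) (h : Fin (H + 1)) (s : S) :
    upperV γ δ r D h s ∈ Set.Icc 0 (sigma γ H) :=
  ⟨(upperV_mem_Icc_sub hγ hr hD h s).1,
    (upperV_mem_Icc_sub hγ hr hD h s).2.trans (sigma_mono hγ (Nat.sub_le _ _))⟩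

lemma lowerV_mem_Icc [Nonempty A] (hγ : 0 ≤ γ) (hr : ∀ h s a, r h s a ∈ Set.Icc (0 : ℝ) 1)
    (hD : ∀ h s a, (confRegion δ D h s a).Nonempty) (h : Fin (H + 1)) (s : S) :
    lowerV γ δ r D h s ∈ Set.Icc 0 (sigma γ H) :=
  ⟨(lowerV_mem_Icc_sub hγ hr hD h s).1,
    (lowerV_mem_Icc_sub hγ hr hD h s).2.trans (sigma_mono hγ (Nat.sub_le _ _))⟩

variable {p : Fin H → S → A → S → ℝ}

lemma bellman_le_upperQ [Nonempty A] (hγ : 0 ≤ γ) (hr : ∀ h s a, r h s a ∈ Set.Icc (0 : ℝ) 1)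
    (hpD : ∀ h s a, p h s a ∈ confRegion δ D h s a) (h : Fin H) (s : S) (a : A) :
    r h s a + γ * ∑ s', p h s a s' * upperV γ δ r D h.succ s' ≤ upperQ γ δ r D h s a := by
  have hV := upperV_mem_Icc hγ hr (fun h s a => ⟨_, hpD h s a⟩) h.succ
  have himg := image_confRegion_subset δ D h s a hV
  unfold upperQ upperBackup
  gcongr
  exact le_csSup ⟨_, fun x hx => (himg hx).2⟩ ⟨_, hpD h s a, rfl⟩

lemma lowerQ_le_bellman [Nonempty A] (hγ : 0 ≤ γ) (hr : ∀ h s a, r h s a ∈ Set.Icc (0 : ℝ) 1)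
    (hpD : ∀ h s a, p h s a ∈ confRegion δ D h s a) (h : Fin H) (s : S) (a : A) :
    lowerQ γ δ r D h s a ≤ r h s a + γ * ∑ s', p h s a s' * lowerV γ δ r D h.succ s' := by
  have hV := lowerV_mem_Icc hγ hr (fun h s a => ⟨_, hpD h s a⟩) h.succ
  have himg := image_confRegion_subset δ D h s a hV
  unfold lowerQ lowerBackup
  gcongr
  exact csInf_le ⟨_, fun x hx => (himg hx).1⟩ ⟨_, hpD h s a, rfl⟩

/-- Optimism: `upperV` is a Bellman supersolution for every policy at once. -/
lemma optValue_le_upperV [Nonempty A] (hγ : 0 ≤ γ) (hr : ∀ h s a, r h s a ∈ Set.Icc (0 : ℝ) 1)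
    (hpD : ∀ h s a, p h s a ∈ confRegion δ D h s a) (s₁ : S) :
    optValue γ r p s₁ ≤ upperV γ δ r D 0 s₁ :=
  ciSup_le fun π => value_le_of_bellman hγ (fun h s a => (hpD h s a).1) π _
    (fun s => (upperV_last γ δ r D s).ge)
    (fun h s => (bellman_le_upperQ hγ hr hpD h s _).trans (upperQ_le_upperV _ _ _ _ _ _ _)) s₁

/-- Greediness turns `lowerV` into a Bellman subsolution for this particular policy. -/
lemma lowerV_le_value [Nonempty A] (hγ : 0 ≤ γ) (hr : ∀ h s a, r h s a ∈ Set.Icc (0 : ℝ) 1)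
    (hpD : ∀ h s a, p h s a ∈ confRegion δ D h s a) {π : Policy S A H}
    (hπ : IsGreedy (lowerQ γ δ r D) π) (s₁ : S) :
    lowerV γ δ r D 0 s₁ ≤ value γ r p π s₁ :=
  le_value_of_bellman hγ (fun h s a => (hpD h s a).1) π _ (fun s => (lowerV_last γ δ r D s).le)
    (fun h s => (lowerV_eq_of_isGreedy hπ h s).trans_le (lowerQ_le_bellman hγ hr hpD h s _)) s₁

lemma upperQ_sub_lowerQ_le [Nonempty A] (hγ : 0 ≤ γ) (hγ1 : γ ≤ 1)
    (hr : ∀ h s a, r h s a ∈ Set.Icc (0 : ℝ) 1)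
    (hpD : ∀ h s a, p h s a ∈ confRegion δ D h s a) (h : Fin H) (s : S) (a : A) :
    upperQ γ δ r D h s a - lowerQ γ δ r D h s a ≤
      4 * sigma γ H * width (Fintype.card S) (Fintype.card A) H δ (count D h s a) +
        γ * ∑ s', p h s a s' * (upperV γ δ r D h.succ s' - lowerV γ δ r D h.succ s') := by
  have : Nonempty S := ⟨s⟩
  have hU := upperV_mem_Icc hγ hr (fun h s a => ⟨_, hpD h s a⟩) h.succ
  have hL := lowerV_mem_Icc hγ hr (fun h s a => ⟨_, hpD h s a⟩) h.succ
  set w := 2 * sigma γ H * width (Fintype.card S) (Fintype.card A) H δ (count D h s a) with hw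
  have hw0 : 0 ≤ w := (abs_nonneg _).trans (abs_sum_mul_sub_le_width (hpD h s a) (hpD h s a) hU)
  have h1 : sSup ((fun q : S → ℝ => ∑ s', q s' * upperV γ δ r D h.succ s') ''
      confRegion δ D h s a) ≤ ∑ s', p h s a s' * upperV γ δ r D h.succ s' + w := by
    refine csSup_le ⟨_, _, hpD h s a, rfl⟩ ?_
    rintro _ ⟨q, hq, rfl⟩
    have := (abs_le.1 (abs_sum_mul_sub_le_width (hpD h s a) hq hU)).2
    dsimp only
    linarith
  have h2 : ∑ s', p h s a s' * lowerV γ δ r D h.succ s' - w ≤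
      sInf ((fun q : S → ℝ => ∑ s', q s' * lowerV γ δ r D h.succ s') ''
        confRegion δ D h s a) := by
    refine le_csInf ⟨_, _, hpD h s a, rfl⟩ ?_
    rintro _ ⟨q, hq, rfl⟩
    have := (abs_le.1 (abs_sum_mul_sub_le_width (hpD h s a) hq hL)).1
    dsimp only
    linarith
  unfold upperQ upperBackup lowerQ lowerBackup
  simp_rw [mul_sub, Finset.sum_sub_distrib]
  nlinarith [mul_le_mul_of_nonneg_left h1 hγ, mul_le_mul_of_nonneg_left h2 hγ,
    mul_le_mul_of_nonneg_right hγ1 hw0]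

/-- Along the policy greedy for `upperQ`, the gap is a Bellman subsolution under the true
transitions with the widths as rewards; that policy need not be greedy for `lowerQ`, but `lowerQ ≤
lowerV` has the right direction. -/
lemma upperV_sub_lowerV_le_value [Nonempty A] (hγ : 0 ≤ γ) (hγ1 : γ ≤ 1)
    (hr : ∀ h s a, r h s a ∈ Set.Icc (0 : ℝ) 1)
    (hpD : ∀ h s a, p h s a ∈ confRegion δ D h s a) {π : Policy S A H}
    (hπ : IsGreedy (upperQ γ δ r D) π) (s₁ : S) :
    upperV γ δ r D 0 s₁ - lowerV γ δ r D 0 s₁ ≤ value γ (fun h s a => 4 * sigma γ H *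
      width (Fintype.card S) (Fintype.card A) H δ (count D h s a)) p π s₁ := by
  refine le_value_of_bellman hγ (fun h s a => (hpD h s a).1) π
    (fun h s => upperV γ δ r D h s - lowerV γ δ r D h s) (fun s => ?_) (fun h s => ?_) s₁
  · simp [upperV_last, lowerV_last]
  · refine le_trans ?_ (upperQ_sub_lowerQ_le hγ hγ1 hr hpD h s (π h s))
    rw [upperV_eq_of_isGreedy hπ]
    exact sub_le_sub_left (lowerQ_le_lowerV _ _ _ _ _ _ _) _

end Bounds

/-! ### Real inequalities: widths, telescoping, and inverting the threshold. -/

section Threshold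

/-- A discrete version of `∫ dN / √N`. Since `x t ≤ 1`, the sum at most doubles `max 1 N` in one
step; this produces the constant `1 + √2`. -/
lemma sum_div_sqrt_max_one_le {x : ℕ → ℝ} (hx0 : ∀ i, 0 ≤ x i) (hx1 : ∀ i, x i ≤ 1) (T : ℕ) :
    ∑ t ∈ Finset.range T, x t / √(max 1 (∑ i ∈ Finset.range t, x i)) ≤
      (1 + √2) * √(∑ i ∈ Finset.range T, x i) := by
  induction T with
  | zero => simp
  | succ T ih =>
    rw [Finset.sum_range_succ, Finset.sum_range_succ]
    refine (add_le_add_left ih _).trans ?_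
    have hN : 0 ≤ ∑ i ∈ Finset.range T, x i := Finset.sum_nonneg fun i _ => hx0 i
    set N := ∑ i ∈ Finset.range T, x i
    set y := x T
    have hy0 : 0 ≤ y := hx0 T
    have hy1 : y ≤ 1 := hx1 T
    set M := max 1 N
    have hM1 : 1 ≤ M := le_max_left _ _
    have hMN : N ≤ M := le_max_right _ _
    have h1 : √(N + y) ≤ √2 * √M := by
      rw [← Real.sqrt_mul (by norm_num)]
      exact Real.sqrt_le_sqrt (by linarith)
    have h2 : √N ≤ √M := Real.sqrt_le_sqrt hMN
    have h3 : √N ≤ √(N + y) := Real.sqrt_le_sqrt (by linarith)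
    have hMpos : 0 < √M := Real.sqrt_pos.2 (by linarith)
    have h4 : (√(N + y) - √N) * (√(N + y) + √N) = y := by
      nlinarith [Real.sq_sqrt hN, Real.sq_sqrt (add_nonneg hN hy0)]
    have h5 : y / √M ≤ (1 + √2) * (√(N + y) - √N) := by
      rw [div_le_iff₀ hMpos]
      calc y = (√(N + y) - √N) * (√(N + y) + √N) := h4.symm
        _ ≤ (√(N + y) - √N) * (√2 * √M + √M) :=
            mul_le_mul_of_nonneg_left (add_le_add h1 h2) (sub_nonneg.2 h3)
        _ = _ := by ring
    linarith

variable {nS nA H : ℕ} {δ : ℝ}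

lemma threshold_mono (hS : 1 ≤ nS) {x y : ℝ} (hx : 0 ≤ x) (hxy : x ≤ y) :
    threshold nS nA H δ x ≤ threshold nS nA H δ y := by
  have hm : (0 : ℝ) ≤ (nS : ℝ) - 1 := sub_nonneg.2 (by exact_mod_cast hS)
  have he := Real.exp_pos 1
  unfold threshold
  gcongr

lemma log_le_threshold (hS : 1 ≤ nS) {x : ℝ} (hx : 0 ≤ x) :
    Real.log (2 * nS * nA * H / δ) ≤ threshold nS nA H δ x := by
  have hm : (0 : ℝ) ≤ (nS : ℝ) - 1 := sub_nonneg.2 (by exact_mod_cast hS)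
  unfold threshold
  refine le_add_of_nonneg_right (mul_nonneg hm (Real.log_nonneg ?_))
  have h1 : 1 ≤ Real.exp 1 := Real.one_le_exp zero_le_one
  have h2 : 1 ≤ 1 + x / ((nS : ℝ) - 1) := le_add_of_nonneg_right (by positivity)
  exact one_le_mul_of_one_le_of_one_le h1 h2

/-- If `N ≤ 4L`, the right side is at least `1` because `β ≥ L ≥ 1`. Otherwise `n ≥ N / 2 - L ≥ N /
4`, and the radius is monotone in the threshold. -/
lemma width_le (hS : 1 ≤ nS) {L : ℝ} (hL : L = Real.log (2 * nS * nA * H / δ)) (hL1 : 1 ≤ L)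
    {n T : ℕ} (hn : n ≤ T) {N : ℝ} (hN : N / 2 - L ≤ n) :
    width nS nA H δ n ≤ 2 * √(threshold nS nA H δ T) / √(max 1 N) := by
  have hβL : L ≤ threshold nS nA H δ T := hL ▸ log_le_threshold hS (Nat.cast_nonneg T)
  have hM : 0 < max 1 N := lt_max_of_lt_left one_pos
  have h4 : 2 * √(threshold nS nA H δ T) / √(max 1 N) =
      √(4 * threshold nS nA H δ T / max 1 N) := by
    rw [Real.sqrt_div' _ hM.le, Real.sqrt_mul (by norm_num), show √(4 : ℝ) = 2 by
      rw [show (4 : ℝ) = 2 ^ 2 by norm_num, Real.sqrt_sq (by norm_num)]]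
  rw [h4]
  rcases le_or_gt N (4 * L) with hNL | hNL
  · have h1 : width nS nA H δ n ≤ 1 := by
      unfold width
      split_ifs
      · exact le_rfl
      · exact min_le_left _ _
    refine h1.trans (Real.one_le_sqrt.2 ((one_le_div hM).2 (max_le ?_ ?_))) <;> linarith
  · have hn0 : (0 : ℝ) < n := by linarith
    have hn0' : n ≠ 0 := by
      rintro rfl
      simp at hn0
    unfold width
    rw [if_neg hn0']
    refine (min_le_right _ _).trans (Real.sqrt_le_sqrt ?_)
    rw [max_eq_right (by linarith)]
    have hβ : threshold nS nA H δ n ≤ threshold nS nA H δ T :=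
      threshold_mono hS (Nat.cast_nonneg n) (by exact_mod_cast hn)
    rw [div_le_div_iff₀ hn0 (by linarith)]
    nlinarith

lemma log_le_sqrt {x : ℝ} (hx : 0 < x) : Real.log x ≤ √x := by
  have h1 : Real.log x = 2 * Real.log √x := by
    rw [Real.log_sqrt hx.le]
    ring
  have hs := Real.sqrt_pos.2 hx
  have h2 : Real.log (√x / Real.exp 1) ≤ √x / Real.exp 1 - 1 :=
    Real.log_le_sub_one_of_pos (by positivity)
  rw [Real.log_div hs.ne' (Real.exp_ne_zero 1), Real.log_exp] at h2
  have h3 : √x / Real.exp 1 ≤ √x / 2 := by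
    gcongr
    linarith [Real.add_one_le_exp (1 : ℝ)]
  linarith

/-- Bootstrapping: the crude bound `log x ≤ √x` makes the hypothesis quadratic in `√(m + T)`, and
the resulting polynomial bound on `T` is put back into the logarithm. The exponent `2` in `hmain`
becomes the factor in `2 * m`. -/
lemma le_mul_of_le_mul_threshold {K L m T : ℝ} (hK : 1 ≤ K) (hL : 0 ≤ L)
    (hm : m = 0 ∨ 1 ≤ m) (hT : 0 ≤ T)
    (h : T ≤ K * (L + m * Real.log (Real.exp 1 * (1 + T / m)))) :
    T ≤ K * (L + 2 * m * Real.log (K * (L + m * (√(Real.exp 1) + √(Real.exp 1 / m)))) + m) := by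
  rcases hm with rfl | hm
  · simpa using h
  have hm0 : 0 < m := by linarith
  have he : 1 ≤ √(Real.exp 1) := Real.one_le_sqrt.2 (Real.one_le_exp zero_le_one)
  have hu : 0 < 1 + T / m := by positivity
  have hmain : 1 + T / m ≤ (K * (L + m * (√(Real.exp 1) + √(Real.exp 1 / m)))) ^ 2 := by
    have hY : m * √(Real.exp 1 * (1 + T / m)) = √(Real.exp 1) * √m * √(m + T) := by
      rw [Real.sqrt_mul (Real.exp_pos 1).le, show 1 + T / m = (m + T) / m by field_simp,
        Real.sqrt_div' _ hm0.le]
      have := Real.mul_self_sqrt hm0.le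
      have hsm := Real.sqrt_pos.2 hm0
      field_simp
      rw [Real.sq_sqrt hm0.le]
    have hX : m * (√(Real.exp 1) + √(Real.exp 1 / m)) = m * √(Real.exp 1) +
        √(Real.exp 1) * √m := by
      rw [Real.sqrt_div' _ hm0.le, mul_add]
      congr 1
      have hsm := Real.sqrt_pos.2 hm0
      field_simp
      rw [Real.sq_sqrt hm0.le]
    have h1 : T ≤ K * (L + √(Real.exp 1) * √m * √(m + T)) := by
      refine h.trans ?_
      rw [← hY]
      gcongr
      exact log_le_sqrt (by positivity)
    have hU1 : 1 ≤ √(m + T) := Real.one_le_sqrt.2 (by linarith)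
    have hUU := Real.mul_self_sqrt (show 0 ≤ m + T by linarith)
    rw [hX]
    set U := √(m + T)
    set e := √(Real.exp 1)
    have hb : 0 ≤ √m := Real.sqrt_nonneg m
    set b := √m
    -- `U * U = m + T`: the summand `m * e` absorbs `m`, and `U ≥ 1` makes every term linear in `U`.
    have h2 : U * U ≤ (K * (L + (m * e + e * b))) * U := by
      have h3 : m ≤ K * (m * e) * U := by
        have : 1 ≤ K * e * U :=
          one_le_mul_of_one_le_of_one_le (one_le_mul_of_one_le_of_one_le hK he) hU1
        nlinarith
      have h4 : K * L ≤ K * L * U := le_mul_of_one_le_right (by positivity) hU1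
      nlinarith
    have h5 : U ≤ K * (L + (m * e + e * b)) := le_of_mul_le_mul_right h2 (by linarith)
    calc 1 + T / m ≤ m + T := by
          have : T / m ≤ T := div_le_self hT hm
          linarith
      _ = U ^ 2 := by rw [sq, hUU]
      _ ≤ _ := by gcongr
  have hlog := Real.log_le_log hu hmain
  rw [Real.log_pow] at hlog
  refine h.trans ?_
  rw [Real.log_mul (Real.exp_ne_zero 1) hu.ne', Real.log_exp]
  have hK0 : 0 ≤ K := by linarith
  refine mul_le_mul_of_nonneg_left ?_ hK0
  push_cast at hlog
  nlinarith

end Threshold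

/-! ### Bounding the stopping time on the regular event. -/

section Stopping

variable {S A : Type*} [Fintype S] [Fintype A] [DecidableEq S] [DecidableEq A] {H : ℕ}
  {γ ε δ : ℝ} {r : Fin H → S → A → ℝ} {s₁ : S} {alg : Algorithm S A H}
  {p : Fin H → S → A → S → ℝ} {Ω : Type*} {Z : ℕ → Ω → Episode S A H} {ω : Ω}

lemma sum_pseudoCount (hp : ∀ h s a, p h s a ∈ stdSimplex ℝ S) (T : ℕ) (h : Fin H) :
    ∑ x : S × A, pseudoCount alg p s₁ h x.1 x.2 T (historyOf Z T ω) = T := by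
  simp_rw [pseudoCount_historyOf]
  rw [Finset.sum_comm]
  simp_rw [sum_occupancy hp]
  simp

/-- Cauchy–Schwarz over the `SA` pairs, whose conditional counts at a fixed step add up to `T`. -/
lemma sum_sqrt_pseudoCount_le (hp : ∀ h s a, p h s a ∈ stdSimplex ℝ S) (T : ℕ) (h : Fin H) :
    ∑ x : S × A, √(pseudoCount alg p s₁ h x.1 x.2 T (historyOf Z T ω)) ≤
      √(Fintype.card S * Fintype.card A * T) := by
  refine Real.le_sqrt_of_sq_le ((sq_sum_le_card_mul_sum_sq).trans_eq ?_)
  have h1 : ∀ x : S × A, √(pseudoCount alg p s₁ h x.1 x.2 T (historyOf Z T ω)) ^ 2 =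
      pseudoCount alg p s₁ h x.1 x.2 T (historyOf Z T ω) := by
    intro x
    refine Real.sq_sqrt ?_
    rw [pseudoCount_historyOf]
    exact Finset.sum_nonneg fun i _ => occupancy_nonneg hp _ _ _ _ _
  simp_rw [h1, sum_pseudoCount hp]
  simp

lemma IsRegular.sum_occupancy_mul_width_le (hω : IsRegular alg p s₁ δ Z ω)
    (hL : 1 ≤ Real.log (2 * Fintype.card S * Fintype.card A * H / δ)) (T : ℕ) (h : Fin H)
    (s : S) (a : A) :
    ∑ t ∈ Finset.range T, occupancy p (alg.policy t (historyOf Z t ω)) s₁ h s a *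
        width (Fintype.card S) (Fintype.card A) H δ (count (historyOf Z t ω) h s a) ≤
      2 * (1 + √2) * √(threshold (Fintype.card S) (Fintype.card A) H δ T) *
        √(pseudoCount alg p s₁ h s a T (historyOf Z T ω)) := by
  have hp : ∀ h s a, p h s a ∈ stdSimplex ℝ S := fun h s a => (hω 0 h s a).1.1
  have hS : 1 ≤ Fintype.card S := Fintype.card_pos_iff.2 ⟨s⟩
  set x : ℕ → ℝ := fun t => occupancy p (alg.policy t (historyOf Z t ω)) s₁ h s a
  have hx0 : ∀ t, 0 ≤ x t := fun t => occupancy_nonneg hp _ _ _ _ _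
  set β := threshold (Fintype.card S) (Fintype.card A) H δ T
  calc _ ≤ ∑ t ∈ Finset.range T, x t * (2 * √β / √(max 1 (∑ i ∈ Finset.range t, x i))) := by
        refine Finset.sum_le_sum fun t ht => mul_le_mul_of_nonneg_left ?_ (hx0 t)
        refine width_le hS rfl hL ((count_le _ h s a).trans (Finset.mem_range.1 ht).le) ?_
        have := (hω t h s a).2
        rwa [pseudoCount_historyOf] at this
    _ = 2 * √β * ∑ t ∈ Finset.range T, x t / √(max 1 (∑ i ∈ Finset.range t, x i)) := by
        rw [Finset.mul_sum]
        exact Finset.sum_congr rfl fun t _ => by ring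
    _ ≤ 2 * √β * ((1 + √2) * √(∑ i ∈ Finset.range T, x i)) := by
        gcongr
        exact sum_div_sqrt_max_one_le hx0 (fun t => occupancy_le_one hp _ _ _ _ _) T
    _ = _ := by
        rw [pseudoCount_historyOf]
        ring

lemma sigma_eq_sum_fin (γ : ℝ) (H : ℕ) : sigma γ H = ∑ h : Fin H, γ ^ (h : ℕ) :=
  (Fin.sum_univ_eq_sum_range (fun i => γ ^ i) H).symm

lemma IsRegular.le_mul_threshold (hω : IsRegular alg p s₁ δ Z ω)
    (halg : IsBPIUCRL alg γ ε δ r s₁) (hγ : 0 < γ) (hγ1 : γ ≤ 1) (hε : 0 < ε) [Nonempty A]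
    (hr : ∀ h s a, r h s a ∈ Set.Icc (0 : ℝ) 1)
    (hL : 1 ≤ Real.log (2 * Fintype.card S * Fintype.card A * H / δ)) {T : ℕ}
    (hT : ∀ t < T, ¬ alg.halts t (historyOf Z t ω)) :
    (T : ℝ) ≤ constC γ H * Fintype.card S * Fintype.card A / ε ^ 2 *
      threshold (Fintype.card S) (Fintype.card A) H δ T := by
  have hp : ∀ h s a, p h s a ∈ stdSimplex ℝ S := fun h s a => (hω 0 h s a).1.1
  have hS : 1 ≤ Fintype.card S := Fintype.card_pos_iff.2 ⟨s₁⟩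
  set β := threshold (Fintype.card S) (Fintype.card A) H δ T
  have hβ : 0 ≤ β := zero_le_one.trans (hL.trans (log_le_threshold hS T.cast_nonneg))
  set σ := sigma γ H with hσ
  have hσ0 : 0 ≤ σ := Finset.sum_nonneg fun i _ => pow_nonneg hγ.le i
  set w : ℕ → Fin H → S × A → ℝ := fun t h x =>
    width (Fintype.card S) (Fintype.card A) H δ (count (historyOf Z t ω) h x.1 x.2)
  set o : ℕ → Fin H → S × A → ℝ := fun t h x =>
    occupancy p (alg.policy t (historyOf Z t ω)) s₁ h x.1 x.2
  have hstep : ∀ t ∈ Finset.range T,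
      ε ≤ ∑ h : Fin H, γ ^ (h : ℕ) * ∑ x : S × A, o t h x * (4 * σ * w t h x) := by
    intro t ht
    have h1 := hT t (Finset.mem_range.1 ht)
    rw [halg.halts_iff, not_le] at h1
    refine h1.le.trans ((upperV_sub_lowerV_le_value hγ.le hγ1 hr (fun h s a => (hω t h s a).1)
      (halg.greedy_upper t _) s₁).trans_eq ?_)
    rw [value_eq_sum_occupancy]
  have hsum : T * ε ≤ 8 * (1 + √2) * σ ^ 2 * √β * √(Fintype.card S * Fintype.card A * T) := by
    calc T * ε = ∑ t ∈ Finset.range T, ε := by simp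
      _ ≤ ∑ t ∈ Finset.range T,
          ∑ h : Fin H, γ ^ (h : ℕ) * ∑ x : S × A, o t h x * (4 * σ * w t h x) :=
          Finset.sum_le_sum hstep
      _ = ∑ h : Fin H, γ ^ (h : ℕ) * (4 * σ *
          ∑ x : S × A, ∑ t ∈ Finset.range T, o t h x * w t h x) := by
          rw [Finset.sum_comm]
          refine Finset.sum_congr rfl fun h _ => ?_
          rw [← Finset.mul_sum, Finset.sum_comm]
          simp_rw [Finset.mul_sum]
          exact Finset.sum_congr rfl fun x _ => Finset.sum_congr rfl fun t _ => by ring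
      _ ≤ ∑ h : Fin H, γ ^ (h : ℕ) * (4 * σ * (2 * (1 + √2) * √β *
          √(Fintype.card S * Fintype.card A * T))) := by
          refine Finset.sum_le_sum fun h _ => ?_
          have h1 : ∑ x : S × A, ∑ t ∈ Finset.range T, o t h x * w t h x ≤
              2 * (1 + √2) * √β * √(Fintype.card S * Fintype.card A * T) := by
            refine (Finset.sum_le_sum fun x _ =>
              hω.sum_occupancy_mul_width_le hL T h x.1 x.2).trans ?_
            rw [← Finset.mul_sum]
            gcongr
            exact sum_sqrt_pseudoCount_le hp T h
          gcongr
      _ = _ := by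
          rw [← Finset.sum_mul, ← sigma_eq_sum_fin, ← hσ]
          ring
  rcases T.eq_zero_or_pos with hT0 | hT0
  · rw [hT0, Nat.cast_zero]
    unfold constC
    positivity
  have hT0' : (0 : ℝ) < T := by exact_mod_cast hT0
  have hsq : (T * ε) ^ 2 ≤ (8 * (1 + √2) * σ ^ 2 * √β *
      √(Fintype.card S * Fintype.card A * T)) ^ 2 := by gcongr
  -- Squaring `8 (1 + √2) σ²` gives the constant `constC`.
  have hsq' : (T * ε) ^ 2 ≤ constC γ H * (Fintype.card S * Fintype.card A * T) * β := by
    refine hsq.trans_eq ?_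
    rw [mul_pow, Real.sq_sqrt (by positivity), mul_pow, Real.sq_sqrt hβ, constC]
    ring
  rw [div_mul_eq_mul_div, le_div_iff₀ (by positivity)]
  refine le_of_mul_le_mul_left ?_ hT0'
  linarith

lemma one_le_log_two_mul_div (hS : 1 ≤ Fintype.card S) (hA : 2 ≤ Fintype.card A) (hH : 1 ≤ H)
    (hδ : 0 < δ) (hδ1 : δ < 1) :
    1 ≤ Real.log (2 * Fintype.card S * Fintype.card A * H / δ) := by
  have hS' : (1 : ℝ) ≤ Fintype.card S := by exact_mod_cast hS
  have hA' : (2 : ℝ) ≤ Fintype.card A := by exact_mod_cast hA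
  have hH' : (1 : ℝ) ≤ H := by exact_mod_cast hH
  have h4 : (4 : ℝ) ≤ 2 * Fintype.card S * Fintype.card A * H / δ := by
    rw [le_div_iff₀ hδ]
    calc 4 * δ ≤ 2 * 1 * 2 * 1 := by linarith
      _ ≤ 2 * Fintype.card S * Fintype.card A * H := by gcongr
  rw [Real.le_log_iff_exp_le (by linarith)]
  linarith [Real.exp_one_lt_d9]

lemma one_le_constC_mul_div (hS : 1 ≤ Fintype.card S) (hA : 1 ≤ Fintype.card A) (hH : 1 ≤ H)
    (hγ : 0 ≤ γ) (hε : 0 < ε) (hεσ : ε ≤ sigma γ H) :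
    1 ≤ constC γ H * Fintype.card S * Fintype.card A / ε ^ 2 := by
  have hS' : (1 : ℝ) ≤ Fintype.card S := by exact_mod_cast hS
  have hA' : (1 : ℝ) ≤ Fintype.card A := by exact_mod_cast hA
  have hσ : 1 ≤ sigma γ H := by simpa [sigma] using sigma_mono hγ hH
  have h2 : 1 ≤ (1 + √2) ^ 2 := one_le_pow₀ (le_add_of_nonneg_right (Real.sqrt_nonneg 2))
  rw [one_le_div (by positivity)]
  calc ε ^ 2 ≤ sigma γ H ^ 2 := by gcongr
    _ ≤ sigma γ H ^ 4 := pow_le_pow_right₀ hσ (by norm_num)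
    _ = 1 * 1 * sigma γ H ^ 4 * 1 * 1 := by ring
    _ ≤ 64 * (1 + √2) ^ 2 * sigma γ H ^ 4 * Fintype.card S * Fintype.card A := by
        gcongr
        norm_num

lemma IsRegular.le_max_sampleBound (hω : IsRegular alg p s₁ δ Z ω)
    (halg : IsBPIUCRL alg γ ε δ r s₁) (hγ : 0 < γ) (hγ1 : γ ≤ 1) (hε : 0 < ε) (hδ : 0 < δ)
    (hδ1 : δ < 1) (hA : 2 ≤ Fintype.card A) (hH : 1 ≤ H)
    (hr : ∀ h s a, r h s a ∈ Set.Icc (0 : ℝ) 1) {T : ℕ}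
    (hT : ∀ t < T, ¬ alg.halts t (historyOf Z t ω)) :
    (T : ℝ) ≤ max 0 (sampleBound (Fintype.card S) (Fintype.card A) H γ ε δ) := by
  rcases T.eq_zero_or_pos with rfl | hT0
  · simp
  refine le_max_of_le_right ?_
  have hS : 1 ≤ Fintype.card S := Fintype.card_pos_iff.2 ⟨s₁⟩
  have : Nonempty A := Fintype.card_pos_iff.1 (by omega)
  have hL := one_le_log_two_mul_div (S := S) (A := A) hS hA hH hδ hδ1
  -- The initial gap never exceeds `σ_H`, so not stopping at `t = 0` forces `ε ≤ σ_H` and thus `K ≥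
  -- 1`. The other case is covered by the maximum with `0`.
  have hεσ : ε ≤ sigma γ H := by
    have h0 := hT 0 hT0
    rw [halg.halts_iff, not_le] at h0
    have hne : ∀ h s a, (confRegion δ (historyOf Z 0 ω) h s a).Nonempty :=
      fun h s a => ⟨_, (hω 0 h s a).1⟩
    linarith [(upperV_mem_Icc hγ.le hr hne 0 s₁).2, (lowerV_mem_Icc hγ.le hr hne 0 s₁).1]
  refine le_mul_of_le_mul_threshold
    (one_le_constC_mul_div hS (one_le_two.trans hA) hH hγ.le hε hεσ)
    (zero_le_one.trans hL) ?_ T.cast_nonneg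
    (hω.le_mul_threshold halg hγ hγ1 hε hr hL hT)
  rcases hS.eq_or_lt with h1 | h1
  · left
    rw [← h1]
    simp
  · right
    have : (2 : ℝ) ≤ Fintype.card S := by exact_mod_cast h1
    linarith

lemma IsRegular.exists_stoppingTime_eq (hω : IsRegular alg p s₁ δ Z ω)
    (halg : IsBPIUCRL alg γ ε δ r s₁) (hγ : 0 < γ) (hγ1 : γ ≤ 1) (hε : 0 < ε) (hδ : 0 < δ)
    (hδ1 : δ < 1) (hA : 2 ≤ Fintype.card A) (hH : 1 ≤ H)
    (hr : ∀ h s a, r h s a ∈ Set.Icc (0 : ℝ) 1) :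
    ∃ t : ℕ, stoppingTime alg Z ω = t ∧ alg.halts t (historyOf Z t ω) ∧
      (t : ℝ) ≤ max 0 (sampleBound (Fintype.card S) (Fintype.card A) H γ ε δ) := by
  classical
  have hbound : ∀ T : ℕ, (∀ t < T, ¬ alg.halts t (historyOf Z t ω)) →
      (T : ℝ) ≤ max 0 (sampleBound (Fintype.card S) (Fintype.card A) H γ ε δ) :=
    fun T hT => hω.le_max_sampleBound halg hγ hγ1 hε hδ hδ1 hA hH hr hT
  have hex : ∃ t, alg.halts t (historyOf Z t ω) := by
    by_contra hno
    obtain ⟨T, hT⟩ := exists_nat_gt (max 0 (sampleBound (Fintype.card S) (Fintype.card A) H γ ε δ))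
    exact absurd (hbound T fun t _ ht => hno ⟨t, ht⟩) (not_le.2 hT)
  refine ⟨Nat.find hex, le_antisymm (sInf_le ⟨_, Nat.find_spec hex, rfl⟩) (le_sInf ?_),
    Nat.find_spec hex, hbound _ fun t ht => Nat.find_min hex ht⟩
  rintro _ ⟨t, ht, rfl⟩
  exact Nat.cast_le.2 (Nat.find_min' hex ht)

lemma IsRegular.optValue_sub_value_le [Nonempty A] (hω : IsRegular alg p s₁ δ Z ω)
    (halg : IsBPIUCRL alg γ ε δ r s₁) (hγ : 0 ≤ γ)
    (hr : ∀ h s a, r h s a ∈ Set.Icc (0 : ℝ) 1) {t : ℕ} (ht : alg.halts t (historyOf Z t ω)) :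
    optValue γ r p s₁ - value γ r p (alg.recommend t (historyOf Z t ω)) s₁ ≤ ε := by
  have hpD := fun h s a => (hω t h s a).1
  linarith [(halg.halts_iff t _).1 ht, optValue_le_upperV hγ hr hpD s₁,
    lowerV_le_value hγ hr hpD (halg.greedy_lower t _) s₁]

end Stopping

end

end BPI

theorem theorem2 {S A : Type*} [Fintype S] [Fintype A] [DecidableEq S] [DecidableEq A]
    (hA : 2 ≤ Fintype.card A) {H : ℕ} (hH : 1 ≤ H)
    {γ ε δ : ℝ} (hγ : 0 < γ) (hγ1 : γ ≤ 1) (hε : 0 < ε) (hδ : 0 < δ) (hδ1 : δ < 1)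
    (r : Fin H → S → A → ℝ) (hr : ∀ h s a, r h s a ∈ Set.Icc (0 : ℝ) 1) (s₁ : S)
    (alg : BPI.Algorithm S A H) (halg : BPI.IsBPIUCRL alg γ ε δ r s₁)
    (p : Fin H → S → A → S → ℝ) (hp : ∀ h s a, p h s a ∈ stdSimplex ℝ S)
    {Ω : Type*} [MeasurableSpace Ω] (μ : MeasureTheory.Measure Ω)
    [MeasureTheory.IsProbabilityMeasure μ]
    (Z : ℕ → Ω → BPI.Episode S A H) (hZ : BPI.IsRun μ alg p s₁ Z) :
    1 - δ ≤ μ.real {ω | BPI.Succeeds alg γ ε r p s₁ Z ω} ∧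
      1 - δ ≤ μ.real {ω | ∃ t : ℕ, BPI.stoppingTime alg Z ω = t ∧
        (t : ℝ) ≤ max 0 (BPI.sampleBound (Fintype.card S) (Fintype.card A) H γ ε δ)} := by
  have hA0 : 0 < Fintype.card A := by omega
  have : Nonempty A := Fintype.card_pos_iff.1 hA0
  have hreg := hZ.one_sub_le_real_isRegular hp hδ hH hA0
  refine ⟨hreg.trans (MeasureTheory.measureReal_mono fun ω hω => ?_),
    hreg.trans (MeasureTheory.measureReal_mono fun ω hω => ?_)⟩
  · obtain ⟨t, hst, hhalt, -⟩ :=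
      hω.exists_stoppingTime_eq halg hγ hγ1 hε hδ hδ1 hA hH hr
    exact ⟨t, hst, hω.optValue_sub_value_le halg hγ.le hr hhalt⟩
  · obtain ⟨t, hst, -, hle⟩ :=
      hω.exists_stoppingTime_eq halg hγ hγ1 hε hδ hδ1 hA hH hr
    exact ⟨t, hst, hle⟩
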